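/- \textbf{Conventions.} Boolean algebras have operations $\vee,\wedge,{}^*$ and bounds $0,1$ ($0=1$ is allowed). A complete Boolean homomorphism $\varphi:A\to B$ preserves complements and arbitrary joins and meets; $\varphi_\Lambda:B\to A$ denotes its lower adjoint, $\varphi_\Lambda(b)\le a\iff b\le\varphi(a)$. In all categories below composition is composition of functions. Two categories are \emph{isomorphic} if there are functors between them whose two composites are equal to the identity functors, and \emph{dually equivalent} if the opposite of one is equivalent to the other. \textbf{Local contact algebras.} A contact relation on a Boolean algebra $B$ is a binary relation $\rho$ such that: $a\neq0$ implies $a\rho a$; $a\rho b$ implies $a\ne0\ne b$; $a\rho b$ implies $b\rho a$; and $a\rho(b\vee c)$ iff $a\rho b$ or $a\rho c$. Write $a\ll_\rho b$ iff not $a\rho b^*$. A \emph{complete local contact algebra} (CLCA) is a triple $(B,\rho,\mathbb B)$ with $B$ a complete Boolean algebra, $\rho$ a contact relation on $B$, and $\mathbb B\subseteq B$ containing $0$, closed downwards and under finite joins, such that: if $a\in\mathbb B$ and $a\ll_\rho c$ then $a\ll_\rho b\ll_\rho c$ for some $b\in\mathbb B$; if $a\rho b$ then $a\rho(c\wedge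 b)$ for some $c\in\mathbb B$; if $a\neq0$ then $b\ll_\rho a$ for some $b\in\mathbb B\setminus\{0\}$. It is \emph{connected} if $a\rho a^*$ for all $a\ne0,1$. Let $\mathbf{SALC}$ be the category of connected CLCAs whose morphisms $(A,\rho,\mathbb B)\to(B,\eta,\mathbb B')$ are the complete Boolean homomorphisms $\varphi$ with (L1) $\varphi(a)\eta\varphi(b)\Rightarrow a\rho b$; (L2) $b\in\mathbb B'\Rightarrow\varphi_\Lambda(b)\in\mathbb B$; (L3) $a\in\mathbb B\Rightarrow\varphi(a)\in\mathbb B'$. Let $\mathbf{OPALC}$ have the same objects and those morphisms of $\mathbf{SALC}$ which also satisfy (LO): for $a\in A$, $b\in\mathbb B'$, $\varphi_\Lambda(b)\rho a\Rightarrow b\,\eta\,\varphi(a)$. \textbf{MVD-algebras.} A \emph{complete MVD-algebra} is a complete Boolean algebra $B$ with a binary relation $\ll$ such that: $a\ll b\Rightarrow a\le b$; $0\ll0$; $a\le b\ll c\le t\Rightarrow a\ll t$; $a,b\ll c\Rightarrow a\vee b\ll c$; $a\ll b$ and $a\ll c$ imply $a\ll b\wedge c$; $a\ll c$ implies $a\ll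 b\ll c$ for some $b$; if $a\neq0$ there is $b\ne0$ with $b\ll a$; and $a\ll1$, $b^*\ll a^*$ imply $a\ll b$. It is \emph{connected} if (CONA): for every $a\neq0,1$ there is $c\ll1$ such that $c\wedge a\ll a\vee c^*$ fails. Let $\mathbf{IAC}$ be the category of connected complete MVD-algebras whose morphisms $(B,\ll)\to(B',\ll')$ are the complete Boolean homomorphisms $\varphi$ with (ES1) $a\ll b\Rightarrow\varphi(a)\ll'\varphi(b)$; (S2) $b\ll'1\Rightarrow\varphi_\Lambda(b)\ll1$; (S3) $a\ll1\Rightarrow\varphi(a)\ll'1$. Let $\mathbf{IPAC}$ have the same objects and those morphisms of $\mathbf{IAC}$ which also satisfy (SO): $b\ll'\varphi(a)\Rightarrow\varphi_\Lambda(b)\ll a$ for $a\in B$, $b\in B'$. \textbf{Spaces.} A map is \emph{perfect} if it is continuous, closed and has compact point inverses, and $f:X\to Y$ is \emph{skeletal} if $\operatorname{int}(\operatorname{cl}(f(U)))\neq\emptyset$ for every non-empty open $U\subseteq X$. Let $\mathbf{SLCC}$ (resp. $\mathbf{OPLCC}$) be the category of connected locally compact Hausdorff spaces (the empty space counting as connected)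 and skeletal perfect (resp. open perfect) maps. \textbf{Theorem.} (a) The categories $\mathbf{SALC}$ and $\mathbf{IAC}$ are isomorphic; hence $\mathbf{SLCC}$ and $\mathbf{IAC}$ are dually equivalent. (b) The categories $\mathbf{OPALC}$ and $\mathbf{IPAC}$ are isomorphic; hence $\mathbf{OPLCC}$ and $\mathbf{IPAC}$ are dually equivalent. -/

import Mathlib

open CategoryTheory

universe u

namespace MVDDuality

/-! ### Lower adjoints -/

section LowerAdjoint

/-- The lower adjoint of a meet-preserving map `φ : A → B` of complete Boolean algebras. -/
def lowerAdjoint {A B : Type u} [CompleteBooleanAlgebra A] [CompleteBooleanAlgebra B]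
    (φ : A → B) (b : B) : A :=
  sInf {a | b ≤ φ a}

theorem gc_lowerAdjoint {A B : Type u} [CompleteBooleanAlgebra A] [CompleteBooleanAlgebra B]
    (φ : CompleteLatticeHom A B) : GaloisConnection (lowerAdjoint φ) φ := by
  intro b a
  constructor
  · intro h
    refine le_trans ?_ (OrderHomClass.mono φ h)
    rw [lowerAdjoint, map_sInf]
    apply le_sInf
    rintro _ ⟨x, hx, rfl⟩
    exact hx
  · intro h
    exact sInf_le h

theorem lowerAdjoint_id {A : Type u} [CompleteBooleanAlgebra A] (a : A) :
    lowerAdjoint (CompleteLatticeHom.id A) a = a :=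
  le_antisymm (((gc_lowerAdjoint (CompleteLatticeHom.id A)) _ _).2 le_rfl)
    ((gc_lowerAdjoint (CompleteLatticeHom.id A)).le_u_l a)

theorem lowerAdjoint_comp {A B C : Type u} [CompleteBooleanAlgebra A]
    [CompleteBooleanAlgebra B] [CompleteBooleanAlgebra C]
    (ψ : CompleteLatticeHom B C) (φ : CompleteLatticeHom A B) (c : C) :
    lowerAdjoint (ψ.comp φ) c = lowerAdjoint φ (lowerAdjoint ψ c) := by
  apply eq_of_forall_ge_iff
  intro a
  rw [gc_lowerAdjoint (ψ.comp φ) c a, gc_lowerAdjoint φ _ a, gc_lowerAdjoint ψ c _]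
  rfl

end LowerAdjoint

/-! ### Local contact algebras -/

/-- Contact relations on a Boolean algebra. -/
structure IsContact {B : Type u} [BooleanAlgebra B] (C : B → B → Prop) : Prop where
  refl_of_ne : ∀ a, a ≠ ⊥ → C a a
  ne_bot : ∀ a b, C a b → a ≠ ⊥ ∧ b ≠ ⊥
  symm : ∀ a b, C a b → C b a
  sup_iff : ∀ a b c, C a (b ⊔ c) ↔ C a b ∨ C a c

/-- The non-tangential inclusion `a ≪_C b` of a relation `C`. -/
def NonTangential {B : Type u} [BooleanAlgebra B] (C : B → B → Prop) (a b : B) : Prop :=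
  ¬ C a bᶜ

/-- `(B, ρ, 𝔹)` is a local contact algebra. -/
structure IsLocalContactAlgebra {B : Type u} [BooleanAlgebra B]
    (ρ : B → B → Prop) (𝔹 : Set B) : Prop where
  isContact : IsContact ρ
  bot_mem : ⊥ ∈ 𝔹
  mem_of_le : ∀ a b, a ≤ b → b ∈ 𝔹 → a ∈ 𝔹
  sup_mem : ∀ a b, a ∈ 𝔹 → b ∈ 𝔹 → a ⊔ b ∈ 𝔹
  interpolate : ∀ a c, a ∈ 𝔹 → NonTangential ρ a c →
    ∃ b ∈ 𝔹, NonTangential ρ a b ∧ NonTangential ρ b c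
  bounded_witness : ∀ a b, ρ a b → ∃ c ∈ 𝔹, ρ a (c ⊓ b)
  exists_inside : ∀ a, a ≠ ⊥ → ∃ b ∈ 𝔹, b ≠ ⊥ ∧ NonTangential ρ b a

/-- The objects of `SAL`: complete local contact algebras. -/
structure SAL : Type (u + 1) where
  carrier : Type u
  [str : CompleteBooleanAlgebra carrier]
  contact : carrier → carrier → Prop
  bounded : Set carrier
  isLCA : IsLocalContactAlgebra contact bounded

attribute [instance] SAL.str

/-- The morphisms of `SAL`: complete Boolean homomorphisms satisfying (L1), (L2), (L3). -/
@[ext]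
structure SAL.Hom (A B : SAL.{u}) : Type u where
  toHom : CompleteLatticeHom A.carrier B.carrier
  contact_of_map : ∀ a b, B.contact (toHom a) (toHom b) → A.contact a b
  lower_bounded : ∀ b, b ∈ B.bounded → lowerAdjoint toHom b ∈ A.bounded
  map_bounded : ∀ a, a ∈ A.bounded → toHom a ∈ B.bounded

instance : Category.{u} SAL.{u} where
  Hom := SAL.Hom
  id A :=
    { toHom := CompleteLatticeHom.id A.carrier
      contact_of_map := fun _ _ h => h
      lower_bounded := fun b h => by rw [lowerAdjoint_id]; exact h
      map_bounded := fun _ h => h }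
  comp {A B C} f g :=
    { toHom := g.toHom.comp f.toHom
      contact_of_map := fun a b h => f.contact_of_map a b (g.contact_of_map _ _ h)
      lower_bounded := fun c h => by
        rw [lowerAdjoint_comp]; exact f.lower_bounded _ (g.lower_bounded c h)
      map_bounded := fun a h => g.map_bounded _ (f.map_bounded a h) }

/-- Condition (LO) on morphisms of `SAL`. -/
def openSAL : MorphismProperty SAL.{u} := fun A B φ =>
  ∀ (a : A.carrier) (b : B.carrier), b ∈ B.bounded →
    A.contact (lowerAdjoint φ.toHom b) a → B.contact b (φ.toHom a)

instance : openSAL.{u}.IsMultiplicative where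
  id_mem A := by
    intro a b _ h
    change A.contact (lowerAdjoint (CompleteLatticeHom.id A.carrier) b) a at h
    rw [lowerAdjoint_id] at h
    exact h
  comp_mem {A B C} f g hf hg := by
    intro a c hc h
    change A.contact (lowerAdjoint (g.toHom.comp f.toHom) c) a at h
    rw [lowerAdjoint_comp] at h
    exact hg _ _ hc (hf _ _ (g.lower_bounded c hc) h)

/-- `OPAL`: the objects of `SAL`, with the `SAL`-morphisms satisfying (LO). -/
abbrev OPAL : Type (u + 1) := WideSubcategory openSAL.{u}

/-- Connectedness (CON) of a local contact algebra. -/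
def SAL.IsConnected : ObjectProperty SAL.{u} := fun A =>
  ∀ a : A.carrier, a ≠ ⊥ → a ≠ ⊤ → A.contact a aᶜ

/-- `SALC`: the full subcategory of `SAL` on the connected objects. -/
abbrev SALC : Type (u + 1) := SAL.IsConnected.{u}.FullSubcategory

/-- `OPALC`: the full subcategory of `OPAL` on the connected objects. -/
abbrev OPALC : Type (u + 1) :=
  ObjectProperty.FullSubcategory (C := OPAL.{u}) (fun A => SAL.IsConnected A.obj)

/-! ### MVD-algebras -/

/-- `(B, ≤, ll)` is an MVD-algebra. -/
structure IsMVDAlgebra {B : Type u} [BooleanAlgebra B] (ll : B → B → Prop) : Prop where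
  le_of_ll : ∀ a b, ll a b → a ≤ b
  bot_ll_bot : ll ⊥ ⊥
  mono : ∀ a b c t, a ≤ b → ll b c → c ≤ t → ll a t
  sup_ll : ∀ a b c, ll a c → ll b c → ll (a ⊔ b) c
  ll_inf : ∀ a b c, ll a b → ll a c → ll a (b ⊓ c)
  interpolate : ∀ a c, ll a c → ∃ b, ll a b ∧ ll b c
  exists_inside : ∀ a, a ≠ ⊥ → ∃ b, b ≠ ⊥ ∧ ll b a
  mvd : ∀ a b, ll a ⊤ → ll bᶜ aᶜ → ll a b

/-- The objects of `IA`: complete MVD-algebras. -/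
structure IA : Type (u + 1) where
  carrier : Type u
  [str : CompleteBooleanAlgebra carrier]
  ll : carrier → carrier → Prop
  isMVD : IsMVDAlgebra ll

attribute [instance] IA.str

/-- The morphisms of `IA`: complete Boolean homomorphisms satisfying (ES1), (S2), (S3). -/
@[ext]
structure IA.Hom (A B : IA.{u}) : Type u where
  toHom : CompleteLatticeHom A.carrier B.carrier
  map_ll : ∀ a b, A.ll a b → B.ll (toHom a) (toHom b)
  lower_ll_top : ∀ b, B.ll b ⊤ → A.ll (lowerAdjoint toHom b) ⊤
  map_ll_top : ∀ a, A.ll a ⊤ → B.ll (toHom a) ⊤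

instance : Category.{u} IA.{u} where
  Hom := IA.Hom
  id A :=
    { toHom := CompleteLatticeHom.id A.carrier
      map_ll := fun _ _ h => h
      lower_ll_top := fun b h => by rw [lowerAdjoint_id]; exact h
      map_ll_top := fun _ h => h }
  comp {A B C} f g :=
    { toHom := g.toHom.comp f.toHom
      map_ll := fun a b h => g.map_ll _ _ (f.map_ll a b h)
      lower_ll_top := fun c h => by
        rw [lowerAdjoint_comp]; exact f.lower_ll_top _ (g.lower_ll_top c h)
      map_ll_top := fun a h => g.map_ll_top _ (f.map_ll_top a h) }

/-- Condition (SO) on morphisms of `IA`. -/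
def openIA : MorphismProperty IA.{u} := fun A B φ =>
  ∀ (a : A.carrier) (b : B.carrier),
    B.ll b (φ.toHom a) → A.ll (lowerAdjoint φ.toHom b) a

instance : openIA.{u}.IsMultiplicative where
  id_mem A := by
    intro a b h
    change A.ll (lowerAdjoint (CompleteLatticeHom.id A.carrier) b) a
    rw [lowerAdjoint_id]
    exact h
  comp_mem {A B C} f g hf hg := by
    intro a c h
    change A.ll (lowerAdjoint (g.toHom.comp f.toHom) c) a
    rw [lowerAdjoint_comp]
    exact hf _ _ (hg _ _ h)

/-- `IPA`: complete MVD-algebras, with the `IA`-morphisms satisfying (SO). -/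
abbrev IPA : Type (u + 1) := WideSubcategory openIA.{u}

/-- Connectedness (CONA) of an MVD-algebra. -/
def IA.IsConnected : ObjectProperty IA.{u} := fun A =>
  ∀ a : A.carrier, a ≠ ⊥ → a ≠ ⊤ → ∃ c, A.ll c ⊤ ∧ ¬ A.ll (c ⊓ a) (a ⊔ cᶜ)

/-- `IAC`: the full subcategory of `IA` on the connected objects. -/
abbrev IAC : Type (u + 1) := IA.IsConnected.{u}.FullSubcategory

/-- `IPAC`: the full subcategory of `IPA` on the connected objects. -/
abbrev IPAC : Type (u + 1) :=
  ObjectProperty.FullSubcategory (C := IPA.{u}) (fun A => IA.IsConnected A.obj)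

/-! ### Locally compact Hausdorff spaces -/

/-- Perfect maps: continuous closed maps with compact fibres. -/
structure IsPerfectMap {X Y : Type u} [TopologicalSpace X] [TopologicalSpace Y]
    (f : X → Y) : Prop where
  continuous : Continuous f
  isClosedMap : IsClosedMap f
  isCompact_fiber : ∀ y, IsCompact (f ⁻¹' {y})

theorem isPerfectMap_iff_isProperMap {X Y : Type u} [TopologicalSpace X] [TopologicalSpace Y]
    (f : X → Y) : IsPerfectMap f ↔ IsProperMap f := by
  rw [isProperMap_iff_isClosedMap_and_compact_fibers]
  exact ⟨fun h => ⟨h.1, h.2, h.3⟩, fun h => ⟨h.1, h.2.1, h.2.2⟩⟩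

theorem IsPerfectMap.id {X : Type u} [TopologicalSpace X] :
    IsPerfectMap (fun x : X => x) :=
  ⟨continuous_id, IsClosedMap.id, fun _ => isCompact_singleton⟩

theorem IsPerfectMap.comp {X Y Z : Type u} [TopologicalSpace X] [TopologicalSpace Y]
    [TopologicalSpace Z] {g : Y → Z} {f : X → Y} (hg : IsPerfectMap g) (hf : IsPerfectMap f) :
    IsPerfectMap (g ∘ f) := by
  rw [isPerfectMap_iff_isProperMap] at *
  exact hg.comp hf

/-- Skeletal maps: the closure of the image of a non-empty open set has non-empty interior. -/
def IsSkeletal {X Y : Type u} [TopologicalSpace X] [TopologicalSpace Y] (f : X → Y) : Prop :=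
  ∀ U : Set X, IsOpen U → U.Nonempty → (interior (closure (f '' U))).Nonempty

theorem IsSkeletal.id {X : Type u} [TopologicalSpace X] : IsSkeletal (fun x : X => x) := by
  intro U hU hne
  rw [Set.image_id']
  exact hne.mono (interior_maximal subset_closure hU)

theorem IsSkeletal.comp {X Y Z : Type u} [TopologicalSpace X] [TopologicalSpace Y]
    [TopologicalSpace Z] {g : Y → Z} {f : X → Y} (hg : IsSkeletal g) (hgc : Continuous g)
    (hf : IsSkeletal f) : IsSkeletal (g ∘ f) := by
  intro U hU hne
  refine (hg _ isOpen_interior (hf U hU hne)).mono (interior_mono ?_)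
  refine closure_minimal ?_ isClosed_closure
  rw [Set.image_comp]
  exact (Set.image_mono interior_subset).trans (image_closure_subset_closure_image hgc)

/-- Locally compact Hausdorff spaces and continuous maps. -/
abbrev HLC : Type (u + 1) :=
  ObjectProperty.FullSubcategory
    (fun X : TopCat.{u} => T2Space X ∧ LocallyCompactSpace X)

/-- The underlying function of a morphism of `HLC`. -/
abbrev HLC.fn {X Y : HLC.{u}} (f : X ⟶ Y) : X.obj → Y.obj := fun x => f.hom.hom x

/-- Skeletal perfect maps. -/
def skeletalPerfect : MorphismProperty HLC.{u} := fun _ _ f =>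
  IsSkeletal (HLC.fn f) ∧ IsPerfectMap (HLC.fn f)

instance : skeletalPerfect.{u}.IsMultiplicative where
  id_mem _ := ⟨IsSkeletal.id, IsPerfectMap.id⟩
  comp_mem _ _ hf hg := ⟨hg.1.comp hg.2.continuous hf.1, hg.2.comp hf.2⟩

/-- Open perfect maps. -/
def openPerfect : MorphismProperty HLC.{u} := fun _ _ f =>
  IsOpenMap (HLC.fn f) ∧ IsPerfectMap (HLC.fn f)

instance : openPerfect.{u}.IsMultiplicative where
  id_mem _ := ⟨IsOpenMap.id, IsPerfectMap.id⟩
  comp_mem _ _ hf hg := ⟨hg.1.comp hf.1, hg.2.comp hf.2⟩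

/-- `SLC`: locally compact Hausdorff spaces and skeletal perfect maps. -/
abbrev SLC : Type (u + 1) := WideSubcategory skeletalPerfect.{u}

/-- `OPLC`: locally compact Hausdorff spaces and open perfect maps. -/
abbrev OPLC : Type (u + 1) := WideSubcategory openPerfect.{u}

/-- `SLCC`: connected locally compact Hausdorff spaces and skeletal perfect maps.
The empty space counts as connected, just as the one-element algebra does. -/
abbrev SLCC : Type (u + 1) :=
  ObjectProperty.FullSubcategory (C := SLC.{u}) (fun X => PreconnectedSpace X.obj.obj)

/-- `OPLCC`: connected locally compact Hausdorff spaces and open perfect maps.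
The empty space counts as connected, just as the one-element algebra does. -/
abbrev OPLCC : Type (u + 1) :=
  ObjectProperty.FullSubcategory (C := OPLC.{u}) (fun X => PreconnectedSpace X.obj.obj)

/-- Two categories are isomorphic: there are mutually inverse functors between them, the
composites being equal to the identity functors. -/
def AreIsomorphic (C D : Type (u + 1)) [Category.{u} C] [Category.{u} D] : Prop :=
  ∃ (F : C ⥤ D) (G : D ⥤ C), F ⋙ G = 𝟭 C ∧ G ⋙ F = 𝟭 D

/-- Two categories are dually equivalent. -/
def AreDuallyEquivalent (C D : Type (u + 1)) [Category.{u} C] [Category.{u} D] : Prop :=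
  Nonempty (Cᵒᵖ ≌ D)

end MVDDuality

/-! The isomorphisms of categories keep the Boolean algebra and the underlying homomorphism fixed
and only re-encode the relations. From `ρ` and `𝔹` one takes `a ≪ b` to mean `a ∈ 𝔹` and `a ≪_ρ b`;
back, `𝔹` is `{a | a ≪ 1}`, and `a ρ b` means that `c ∧ a ≪ b*` fails for some `c ≪ 1`. The delicate
point is symmetry of the recovered contact (`inducedContact_symm`). The constructions are mutually
inverse (`boundedInclusion_inducedContact`, `inducedContact_boundedInclusion`), and they match the
morphism conditions and the two notions of connectedness.

The dualities are proved directly for MVD-algebras. A space goes to its regular open sets, with `U ≪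
V` when `cl U` is compact and inside `V`; a skeletal perfect map `f` goes to `V ↦ int cl f⁻¹(V)`,
whose lower adjoint is `U ↦ int cl f(U)`. Faithfulness is Hausdorff separation. For fullness, a
homomorphism `φ` and a point `x` determine the filter of all `V` with `x ∈ φ V`, whose cluster point
is the value at `x` of the required map (`exists_point_of_hom`, `exists_map_of_hom`). For essential
surjectivity, the maximal round filters of an algebra form a locally compact Hausdorff space whose
regular open algebra is the given one (`isCompact_closure_basic`, `exists_basic_eq`, `ll_iff`).
Finally (SO) says exactly that `f` is open (`openIA_homOfMap_iff`). -/

namespace MVDDuality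

/-! ### Translating between contact with bounded elements and the relation `≪`. -/

section Translation

variable {B : Type u} [BooleanAlgebra B]

theorem IsContact.mono {ρ : B → B → Prop} (h : IsContact ρ) {a b c d : B} (hab : a ≤ b)
    (hcd : c ≤ d) (hac : ρ a c) : ρ b d := by
  have key : ∀ {x y z : B}, y ≤ z → ρ x y → ρ x z := fun {x y z} hyz hxy => by
    rw [← sup_eq_right.2 hyz]; exact (h.sup_iff _ _ _).2 (Or.inl hxy)
  exact key hcd (h.symm _ _ (key hab (h.symm _ _ hac)))

theorem IsContact.le_of_nonTangential {ρ : B → B → Prop} (h : IsContact ρ) {a b : B}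
    (hab : NonTangential ρ a b) : a ≤ b := by
  rw [← disjoint_compl_right_iff, disjoint_iff]
  by_contra hne
  exact hab (h.mono inf_le_left inf_le_right (h.refl_of_ne _ hne))

/-- The relation of an MVD-algebra induced by a contact relation and an ideal. -/
def boundedInclusion (ρ : B → B → Prop) (𝔹 : Set B) (a b : B) : Prop :=
  a ∈ 𝔹 ∧ NonTangential ρ a b

theorem boundedInclusion_top {ρ : B → B → Prop} {𝔹 : Set B} (h : IsContact ρ) (a : B) :
    boundedInclusion ρ 𝔹 a ⊤ ↔ a ∈ 𝔹 := by
  refine ⟨And.left, fun ha => ⟨ha, fun hc => ?_⟩⟩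
  exact (h.ne_bot _ _ hc).2 compl_top

theorem IsLocalContactAlgebra.isMVDAlgebra {ρ : B → B → Prop} {𝔹 : Set B}
    (h : IsLocalContactAlgebra ρ 𝔹) : IsMVDAlgebra (boundedInclusion ρ 𝔹) where
  le_of_ll _ _ hab := h.isContact.le_of_nonTangential hab.2
  bot_ll_bot := ⟨h.bot_mem, fun hc => (h.isContact.ne_bot _ _ hc).1 rfl⟩
  mono a b c t hab hbc hct := ⟨h.mem_of_le _ _ hab hbc.1, fun hc =>
    hbc.2 (h.isContact.mono hab (compl_le_compl hct) hc)⟩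
  sup_ll a b c hac hbc := ⟨h.sup_mem _ _ hac.1 hbc.1, fun hc => by
    rcases (h.isContact.sup_iff _ _ _).1 (h.isContact.symm _ _ hc) with hc | hc
    · exact hac.2 (h.isContact.symm _ _ hc)
    · exact hbc.2 (h.isContact.symm _ _ hc)⟩
  ll_inf a b c hab hac := ⟨hab.1, fun hc => by
    rw [compl_inf] at hc
    exact ((h.isContact.sup_iff _ _ _).1 hc).elim hab.2 hac.2⟩
  interpolate a c hac := by
    obtain ⟨b, hb, hab, hbc⟩ := h.interpolate a c hac.1 hac.2
    exact ⟨b, ⟨hac.1, hab⟩, hb, hbc⟩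
  exists_inside a ha := by
    obtain ⟨b, hb, hb0, hba⟩ := h.exists_inside a ha
    exact ⟨b, hb0, hb, hba⟩
  mvd a b ha hab := ⟨ha.1, fun hc => hab.2 (by
    rw [compl_compl]; exact h.isContact.symm _ _ hc)⟩

/-- The contact relation induced by the relation of an MVD-algebra. -/
def inducedContact (ll : B → B → Prop) (a b : B) : Prop :=
  ∃ c, ll c ⊤ ∧ ¬ ll (c ⊓ a) bᶜ

namespace IsMVDAlgebra

variable {ll : B → B → Prop} (h : IsMVDAlgebra ll)
include h

theorem ll_top {a b : B} (hab : ll a b) : ll a ⊤ := h.mono _ _ _ _ le_rfl hab le_top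

theorem bot_ll (a : B) : ll ⊥ a := h.mono _ _ _ _ le_rfl h.bot_ll_bot bot_le

theorem inf_ll_inf {a b c d : B} (hac : ll a c) (hbd : ll b d) : ll (a ⊓ b) (c ⊓ d) :=
  h.ll_inf _ _ _ (h.mono _ _ _ _ inf_le_left hac le_rfl)
    (h.mono _ _ _ _ inf_le_right hbd le_rfl)

/-- The axiom `mvd` contraposes `a ≪ b` only below a bounded element, and `c` supplies that bound.
Symmetry of the induced contact and compactness in the space of ends both rest on this. -/
theorem inf_compl_ll {a b c d : B} (hab : ll a b) (hcd : ll c d) :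
    ll (c ⊓ bᶜ) (d ⊓ aᶜ) := by
  refine h.ll_inf _ _ _ (h.mono _ _ _ _ inf_le_left hcd le_rfl) (h.mvd _ _ ?_ ?_)
  · exact h.mono _ _ _ _ inf_le_left hcd le_top
  · rw [compl_compl, compl_inf, compl_compl]
    exact h.mono _ _ _ _ le_rfl hab le_sup_right

theorem inducedContact_symm {a b : B} (hab : inducedContact ll a b) :
    inducedContact ll b a := by
  by_contra hba
  simp only [inducedContact, not_exists, not_and, not_not] at hba
  obtain ⟨c, hc, hcab⟩ := hab
  -- The room between `c` and `d` allows contraposition of `d ⊓ b ≪ aᶜ`: it yields `c ⊓ a ≪ d ⊓ (d ⊓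
  -- b)ᶜ ≤ bᶜ`.
  obtain ⟨d, hcd, hd⟩ := h.interpolate _ _ hc
  have := h.inf_compl_ll (hba d hd) hcd
  refine hcab (h.mono _ _ _ _ ?_ this ?_)
  · rw [compl_compl]
  · rw [compl_inf, inf_sup_left, inf_compl_eq_bot, bot_sup_eq]
    exact inf_le_right

/-- When `a` is itself bounded, the test element `c = a` is the strongest one, so the quantifier
disappears. -/
theorem nonTangential_inducedContact {a b : B} (ha : ll a ⊤) :
    NonTangential (inducedContact ll) a b ↔ ll a b := by
  simp only [NonTangential, inducedContact, not_exists, not_and, not_not, compl_compl]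
  refine ⟨fun H => ?_, fun H c _ => h.mono _ _ _ _ inf_le_right H le_rfl⟩
  have := H a ha
  rwa [inf_idem] at this

theorem isLocalContactAlgebra :
    IsLocalContactAlgebra (inducedContact ll) {a | ll a ⊤} where
  isContact :=
    { refl_of_ne := fun a ha => by
        obtain ⟨b, hb, hba⟩ := h.exists_inside a ha
        refine ⟨b, h.ll_top hba, fun hc => hb (le_bot_iff.1 ?_)⟩
        have hle := h.le_of_ll _ _ hba
        have := h.le_of_ll _ _ hc
        rw [inf_eq_left.2 hle] at this
        exact (inf_compl_eq_bot (a := a)) ▸ le_inf hle this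
      ne_bot := fun a b ⟨c, hc, hcab⟩ => by
        refine ⟨?_, ?_⟩
        · rintro rfl
          rw [inf_bot_eq] at hcab
          exact hcab (h.bot_ll _)
        · rintro rfl
          rw [compl_bot] at hcab
          exact hcab (h.mono _ _ _ _ inf_le_left hc le_rfl)
      symm := fun _ _ => h.inducedContact_symm
      sup_iff := fun a b c => by
        constructor
        · rintro ⟨d, hd, hda⟩
          by_contra! hn
          simp only [inducedContact, not_exists, not_and, not_not] at hn
          rw [compl_sup] at hda
          exact hda (h.ll_inf _ _ _ (hn.1 d hd) (hn.2 d hd))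
        · rintro (⟨d, hd, hda⟩ | ⟨d, hd, hda⟩)
          · exact ⟨d, hd, fun H => hda (h.mono _ _ _ _ le_rfl H (compl_le_compl le_sup_left))⟩
          · exact ⟨d, hd, fun H => hda (h.mono _ _ _ _ le_rfl H (compl_le_compl le_sup_right))⟩ }
  bot_mem := h.bot_ll _
  mem_of_le a b hab hb := h.mono _ _ _ _ hab hb le_rfl
  sup_mem a b ha hb := h.sup_ll _ _ _ ha hb
  interpolate a c ha hac := by
    obtain ⟨b, hab, hbc⟩ := h.interpolate _ _ ((h.nonTangential_inducedContact ha).1 hac)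
    exact ⟨b, h.ll_top hbc, (h.nonTangential_inducedContact ha).2 hab,
      (h.nonTangential_inducedContact (h.ll_top hbc)).2 hbc⟩
  bounded_witness a b hab := by
    -- The element witnessing the contact is also the required bounded piece, since `c ⊓ (c ⊓ b) = c
    -- ⊓ b`.
    obtain ⟨c, hc, hcb⟩ := h.inducedContact_symm hab
    refine ⟨c, hc, h.inducedContact_symm ⟨c, hc, ?_⟩⟩
    rwa [← inf_assoc, inf_idem]
  exists_inside a ha := by
    obtain ⟨b, hb, hba⟩ := h.exists_inside a ha
    exact ⟨b, h.ll_top hba, hb, (h.nonTangential_inducedContact (h.ll_top hba)).2 hba⟩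

theorem boundedInclusion_inducedContact :
    boundedInclusion (inducedContact ll) {a | ll a ⊤} = ll := by
  ext a b
  exact ⟨fun hab => (h.nonTangential_inducedContact hab.1).1 hab.2, fun hab =>
    ⟨h.ll_top hab, (h.nonTangential_inducedContact (h.ll_top hab)).2 hab⟩⟩

end IsMVDAlgebra

/-- By `bounded_witness` every contact is already visible on a bounded part of one side, so
restricting `≪_ρ` to bounded left arguments loses nothing. -/
theorem IsLocalContactAlgebra.inducedContact_boundedInclusion {ρ : B → B → Prop} {𝔹 : Set B}
    (h : IsLocalContactAlgebra ρ 𝔹) : inducedContact (boundedInclusion ρ 𝔹) = ρ := by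
  ext a b
  constructor
  · rintro ⟨c, hc, hcab⟩
    by_contra hab
    refine hcab ⟨h.mem_of_le _ _ inf_le_left hc.1, fun H => hab ?_⟩
    rw [compl_compl] at H
    exact h.isContact.mono inf_le_right le_rfl H
  · intro hab
    obtain ⟨c, hc, hcab⟩ := h.bounded_witness _ _ (h.isContact.symm _ _ hab)
    refine ⟨c, (boundedInclusion_top h.isContact c).2 hc, fun H => H.2 ?_⟩
    rw [compl_compl]
    exact h.isContact.symm _ _ hcab

end Translation

/-! ### The isomorphism between local contact algebras and MVD-algebras -/

/-- The MVD-algebra of a complete local contact algebra. -/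
abbrev SAL.toIA (A : SAL.{u}) : IA.{u} where
  carrier := A.carrier
  ll := boundedInclusion A.contact A.bounded
  isMVD := A.isLCA.isMVDAlgebra

/-- The complete local contact algebra of an MVD-algebra. -/
abbrev IA.toSAL (A : IA.{u}) : SAL.{u} where
  carrier := A.carrier
  contact := inducedContact A.ll
  bounded := {a | A.ll a ⊤}
  isLCA := A.isMVD.isLocalContactAlgebra

theorem SAL.toSAL_toIA (A : SAL.{u}) : A.toIA.toSAL = A := by
  have h₁ := A.isLCA.inducedContact_boundedInclusion
  have h₂ : {a | boundedInclusion A.contact A.bounded a ⊤} = A.bounded :=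
    Set.ext (boundedInclusion_top A.isLCA.isContact)
  cases A
  simp only [SAL.toIA, IA.toSAL, SAL.mk.injEq, heq_eq_eq, true_and]
  exact ⟨h₁, h₂⟩

theorem IA.toIA_toSAL (A : IA.{u}) : A.toSAL.toIA = A := by
  have h := A.isMVD.boundedInclusion_inducedContact
  cases A
  simp only [SAL.toIA, IA.toSAL, IA.mk.injEq, heq_eq_eq, true_and]
  exact h

/-- A morphism of complete local contact algebras, as a morphism of MVD-algebras. -/
def SAL.Hom.toIA {A B : SAL.{u}} (f : SAL.Hom A B) : IA.Hom A.toIA B.toIA where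
  toHom := f.toHom
  map_ll (a b : A.carrier) hab := ⟨f.map_bounded _ hab.1, fun H => hab.2 (f.contact_of_map _ _ (by
    rw [map_compl']; exact H))⟩
  lower_ll_top b hb := (boundedInclusion_top A.isLCA.isContact _).2 (f.lower_bounded _ hb.1)
  map_ll_top a ha := (boundedInclusion_top B.isLCA.isContact _).2 (f.map_bounded _ ha.1)

/-- A morphism of MVD-algebras, as a morphism of complete local contact algebras. -/
def IA.Hom.toSAL {A B : IA.{u}} (f : IA.Hom A B) : SAL.Hom A.toSAL B.toSAL where
  toHom := f.toHom
  contact_of_map (a b : A.carrier) := by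
    rintro ⟨c, hc, hcab⟩
    -- From `c ≤ φ (φ_Λ c)` one gets `c ⊓ φ a ≤ φ (φ_Λ c ⊓ a)`, so (ES1) transports the relation;
    -- (S2) makes `φ_Λ c` an admissible test element.
    refine ⟨lowerAdjoint f.toHom c, f.lower_ll_top _ hc, fun H => hcab ?_⟩
    have := f.map_ll _ _ H
    refine B.isMVD.mono _ _ _ _ ?_ this (map_compl' f.toHom b).le
    rw [map_inf]
    exact inf_le_inf_right _ ((gc_lowerAdjoint f.toHom).le_u_l c)
  lower_bounded b hb := f.lower_ll_top _ hb
  map_bounded a ha := f.map_ll_top _ ha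

theorem SAL.isConnected_toIA_iff (A : SAL.{u}) : IA.IsConnected A.toIA ↔ SAL.IsConnected A := by
  have key : ∀ a : A.carrier, A.contact a aᶜ ↔
      ∃ c, A.toIA.ll c ⊤ ∧ ¬ A.toIA.ll (c ⊓ a) (a ⊔ cᶜ) := fun a => by
    have hM := A.isLCA.isMVDAlgebra
    rw [← A.isLCA.inducedContact_boundedInclusion]
    constructor
    · rintro ⟨c, hc, hca⟩
      -- Enlarging the test element removes the extra term `dᶜ`: meeting `c ≪ d` with `d ⊓ a ≪ a ⊔
      -- dᶜ` gives `c ⊓ a ≪ d ⊓ (a ⊔ dᶜ) ≤ a`.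
      obtain ⟨d, hcd, hd⟩ := hM.interpolate _ _ hc
      refine ⟨d, hd, fun (H : boundedInclusion A.contact A.bounded (d ⊓ a) (a ⊔ dᶜ)) => hca ?_⟩
      refine hM.mono _ _ _ _ ?_ (hM.inf_ll_inf hcd H) ?_
      · exact le_inf inf_le_left (inf_le_inf_right _ (hM.le_of_ll _ _ hcd))
      · rw [compl_compl, inf_sup_left, inf_compl_eq_bot, sup_bot_eq]
        exact inf_le_right
    · rintro ⟨c, hc, hca⟩
      refine ⟨c, hc, fun H => hca (hM.mono _ _ _ _ le_rfl H ?_)⟩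
      rw [compl_compl]
      exact le_sup_left
  exact forall_congr' fun a => forall_congr' fun _ => forall_congr' fun _ => (key a).symm

theorem IA.isConnected_toSAL_iff (A : IA.{u}) : SAL.IsConnected A.toSAL ↔ IA.IsConnected A := by
  rw [← SAL.isConnected_toIA_iff, IA.toIA_toSAL]

/-- (SO) at `a` is the contrapositive of (LO) at `aᶜ`, with (L2) supplying boundedness. -/
theorem SAL.openIA_toIA {A B : SAL.{u}} {f : A ⟶ B} (hf : openSAL f) :
    openIA (X := A.toIA) (Y := B.toIA) (SAL.Hom.toIA f) := by
  rintro (a : A.carrier) (b : B.carrier) ⟨hb, hba⟩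
  refine ⟨f.lower_bounded _ hb, fun H => hba ?_⟩
  have : B.contact b (f.toHom aᶜ) := hf _ _ hb H
  rwa [map_compl'] at this

theorem IA.openSAL_toSAL {A B : IA.{u}} {f : A ⟶ B} (hf : openIA f) :
    openSAL (X := A.toSAL) (Y := B.toSAL) (IA.Hom.toSAL f) := by
  intro (a : A.carrier) (b : B.carrier) hb H
  by_contra hn
  refine (A.isMVD.nonTangential_inducedContact (b := aᶜ) (f.lower_ll_top _ hb)).2
    (hf _ _ ?_) (by rw [compl_compl]; exact H)
  refine (B.isMVD.nonTangential_inducedContact hb).1 ?_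
  rw [map_compl']
  intro hc
  rw [compl_compl] at hc
  exact hn hc

/-- The round-trip functors fix objects only up to a propositional equality, so morphisms are
compared by `HEq`; the underlying homomorphism is unchanged, which makes the hypothesis `HEq.rfl`
there. -/
theorem SALC.hom_heq {X X' Y Y' : SALC.{u}} (hX : X = X') (hY : Y = Y') {f : X ⟶ Y}
    {f' : X' ⟶ Y'} (h : HEq f.hom.toHom f'.hom.toHom) : HEq f f' := by
  subst hX hY
  exact heq_of_eq (ObjectProperty.hom_ext _ (SAL.Hom.ext (eq_of_heq h)))

theorem IAC.hom_heq {X X' Y Y' : IAC.{u}} (hX : X = X') (hY : Y = Y') {f : X ⟶ Y}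
    {f' : X' ⟶ Y'} (h : HEq f.hom.toHom f'.hom.toHom) : HEq f f' := by
  subst hX hY
  exact heq_of_eq (ObjectProperty.hom_ext _ (IA.Hom.ext (eq_of_heq h)))

theorem OPALC.hom_heq {X X' Y Y' : OPALC.{u}} (hX : X = X') (hY : Y = Y') {f : X ⟶ Y}
    {f' : X' ⟶ Y'} (h : HEq f.hom.hom.toHom f'.hom.hom.toHom) : HEq f f' := by
  subst hX hY
  exact heq_of_eq (ObjectProperty.hom_ext _ (WideSubcategory.hom_ext _
    (SAL.Hom.ext (eq_of_heq h))))

theorem IPAC.hom_heq {X X' Y Y' : IPAC.{u}} (hX : X = X') (hY : Y = Y') {f : X ⟶ Y}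
    {f' : X' ⟶ Y'} (h : HEq f.hom.hom.toHom f'.hom.hom.toHom) : HEq f f' := by
  subst hX hY
  exact heq_of_eq (ObjectProperty.hom_ext _ (WideSubcategory.hom_ext _
    (IA.Hom.ext (eq_of_heq h))))

/-- The functor from connected complete local contact algebras to connected MVD-algebras. -/
def salcToIAC : SALC.{u} ⥤ IAC.{u} where
  obj X := ⟨X.obj.toIA, X.obj.isConnected_toIA_iff.2 X.property⟩
  map f := ObjectProperty.homMk (SAL.Hom.toIA f.hom)

/-- The functor from connected MVD-algebras to connected complete local contact algebras. -/
def iacToSALC : IAC.{u} ⥤ SALC.{u} where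
  obj X := ⟨X.obj.toSAL, X.obj.isConnected_toSAL_iff.2 X.property⟩
  map f := ObjectProperty.homMk (IA.Hom.toSAL f.hom)

theorem areIsomorphic_SALC_IAC : AreIsomorphic SALC.{u} IAC.{u} := by
  refine ⟨salcToIAC, iacToSALC, ?_, ?_⟩
  · have hobj : ∀ X : SALC.{u}, (salcToIAC ⋙ iacToSALC).obj X = X := fun X =>
      ObjectProperty.FullSubcategory.ext X.obj.toSAL_toIA
    exact Functor.hext hobj fun X Y f => SALC.hom_heq (hobj X) (hobj Y) HEq.rfl
  · have hobj : ∀ X : IAC.{u}, (iacToSALC ⋙ salcToIAC).obj X = X := fun X =>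
      ObjectProperty.FullSubcategory.ext X.obj.toIA_toSAL
    exact Functor.hext hobj fun X Y f => IAC.hom_heq (hobj X) (hobj Y) HEq.rfl

/-- The restriction of `salcToIAC` to the morphisms satisfying (LO). -/
def opalcToIPAC : OPALC.{u} ⥤ IPAC.{u} where
  obj X := ⟨⟨X.obj.obj.toIA⟩, X.obj.obj.isConnected_toIA_iff.2 X.property⟩
  map f := ObjectProperty.homMk ⟨SAL.Hom.toIA f.hom.hom, SAL.openIA_toIA f.hom.property⟩

/-- The restriction of `iacToSALC` to the morphisms satisfying (SO). -/
def ipacToOPALC : IPAC.{u} ⥤ OPALC.{u} where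
  obj X := ⟨⟨X.obj.obj.toSAL⟩, X.obj.obj.isConnected_toSAL_iff.2 X.property⟩
  map f := ObjectProperty.homMk ⟨IA.Hom.toSAL f.hom.hom, IA.openSAL_toSAL f.hom.property⟩

theorem areIsomorphic_OPALC_IPAC : AreIsomorphic OPALC.{u} IPAC.{u} := by
  refine ⟨opalcToIPAC, ipacToOPALC, ?_, ?_⟩
  · have hobj : ∀ X : OPALC.{u}, (opalcToIPAC ⋙ ipacToOPALC).obj X = X := fun X =>
      ObjectProperty.FullSubcategory.ext (WideSubcategory.ext X.obj.obj.toSAL_toIA)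
    exact Functor.hext hobj fun X Y f => OPALC.hom_heq (hobj X) (hobj Y) HEq.rfl
  · have hobj : ∀ X : IPAC.{u}, (ipacToOPALC ⋙ opalcToIPAC).obj X = X := fun X =>
      ObjectProperty.FullSubcategory.ext (WideSubcategory.ext X.obj.obj.toIA_toSAL)
    exact Functor.hext hobj fun X Y f => IPAC.hom_heq (hobj X) (hobj Y) HEq.rfl

open TopologicalSpace

/-! ### Regular open sets -/

/-- The Heyting-regular elements of a frame form a complete Boolean algebra. -/
def completeBooleanAlgebraRegular (α : Type*) [Order.Frame α] :
    CompleteBooleanAlgebra (Heyting.Regular α) :=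
  { (inferInstance : BooleanAlgebra (Heyting.Regular α)) with
    sSup := fun s => Heyting.Regular.toRegular (sSup ((↑) '' s))
    isLUB_sSup := fun s => by
      refine ⟨fun a ha => ?_, fun a ha => Heyting.Regular.gi.gc.l_le (sSup_le ?_)⟩
      · rw [← Heyting.Regular.toRegular_coe a]
        exact Heyting.Regular.toRegular.monotone (le_sSup ⟨a, ha, rfl⟩)
      · rintro _ ⟨b, hb, rfl⟩
        exact ha hb
    sInf := fun s => Heyting.Regular.toRegular (sSup ((↑) '' (lowerBounds s)))
    isGLB_sInf := fun s => by
      refine ⟨fun a ha => Heyting.Regular.gi.gc.l_le (sSup_le ?_), fun a ha => ?_⟩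
      · rintro _ ⟨b, hb, rfl⟩
        exact hb ha
      · rw [← Heyting.Regular.toRegular_coe a]
        exact Heyting.Regular.toRegular.monotone (le_sSup ⟨a, ha, rfl⟩) }

/-- The complete Boolean algebra of regular open subsets of a space. -/
def RegularOpens (X : Type*) [TopologicalSpace X] := Heyting.Regular (Opens X)

namespace RegularOpens

variable {X : Type*} [TopologicalSpace X]

instance : CompleteBooleanAlgebra (RegularOpens X) :=
  completeBooleanAlgebraRegular (Opens X)

/-- The regular open set, as an open set. -/
def toOpens (U : RegularOpens X) : Opens X := Heyting.Regular.val U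

/-- The underlying set of a regular open set. -/
def toSet (U : RegularOpens X) : Set X := U.toOpens

theorem isOpen_toSet (U : RegularOpens X) : IsOpen U.toSet := U.toOpens.isOpen

theorem le_iff {U V : RegularOpens X} : U ≤ V ↔ U.toSet ⊆ V.toSet := Iff.rfl

theorem toSet_injective : Function.Injective (toSet (X := X)) := fun _ _ h =>
  le_antisymm (le_iff.2 h.le) (le_iff.2 h.ge)

theorem toSet_inf (U V : RegularOpens X) : (U ⊓ V).toSet = U.toSet ∩ V.toSet := rfl

theorem toSet_bot : (⊥ : RegularOpens X).toSet = ∅ := rfl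

theorem toSet_top : (⊤ : RegularOpens X).toSet = Set.univ := rfl

theorem coe_compl_opens (O : Opens X) : ((Oᶜ : Opens X) : Set X) = (closure (O : Set X))ᶜ := by
  rw [Opens.coe_compl_eq_interior_compl, interior_compl]

theorem toSet_compl (U : RegularOpens X) : Uᶜ.toSet = (closure U.toSet)ᶜ :=
  coe_compl_opens U.toOpens

theorem coe_compl_compl_opens (O : Opens X) :
    ((Oᶜᶜ : Opens X) : Set X) = interior (closure (O : Set X)) := by
  rw [coe_compl_opens, coe_compl_opens, closure_compl, compl_compl]

theorem interior_closure_toSet (U : RegularOpens X) :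
    interior (closure U.toSet) = U.toSet := by
  rw [toSet, ← coe_compl_compl_opens]
  exact congrArg _ (Heyting.Regular.prop U).eq

/-- The regular open set `int (cl W)`. -/
def regularize (W : Set X) : RegularOpens X :=
  Heyting.Regular.toRegular ⟨interior (closure W), isOpen_interior⟩

theorem toSet_regularize (W : Set X) : (regularize W).toSet = interior (closure W) := by
  change ((_ᶜᶜ : Opens X) : Set X) = _
  rw [coe_compl_compl_opens]
  exact interior_closure_idem

theorem regularize_toSet (U : RegularOpens X) : regularize U.toSet = U :=
  toSet_injective (by rw [toSet_regularize, interior_closure_toSet])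

theorem le_regularize_iff {U : RegularOpens X} {W : Set X} :
    U ≤ regularize W ↔ U.toSet ⊆ closure W := by
  rw [le_iff, toSet_regularize, U.isOpen_toSet.subset_interior_iff]

theorem regularize_le {U : RegularOpens X} {W : Set X} (h : W ⊆ closure U.toSet) :
    regularize W ≤ U := by
  rw [le_iff, toSet_regularize, ← U.interior_closure_toSet]
  exact interior_mono (closure_minimal h isClosed_closure)

theorem subset_toSet_regularize {W : Set X} (h : IsOpen W) : W ⊆ (regularize W).toSet := by
  rw [toSet_regularize]
  exact h.subset_interior_closure

theorem closure_toSet_regularize_subset (W : Set X) :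
    closure (regularize W).toSet ⊆ closure W := by
  rw [toSet_regularize]
  exact closure_minimal interior_subset isClosed_closure

theorem toSet_sSup (S : Set (RegularOpens X)) :
    (sSup S).toSet = interior (closure (⋃ U ∈ S, U.toSet)) := by
  change ((_ᶜᶜ : Opens X) : Set X) = _
  rw [coe_compl_compl_opens, Opens.coe_sSup]
  congr 2
  exact Set.biUnion_image

theorem ne_bot_iff {U : RegularOpens X} : U ≠ ⊥ ↔ U.toSet.Nonempty := by
  rw [Set.nonempty_iff_ne_empty, ← toSet_bot, Ne, Ne, toSet_injective.eq_iff]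

theorem disjoint_of_inf_eq_bot {U V : RegularOpens X} (h : U ⊓ V = ⊥) {x : X}
    (hU : x ∈ U.toSet) (hV : x ∈ V.toSet) : False := by
  have : x ∈ (U ⊓ V).toSet := ⟨hU, hV⟩
  rw [h] at this
  exact this

/-- Regular open sets with compact closure form a base, which lets neighbourhood arguments be run
inside the algebra. -/
theorem exists_mem_closure_subset [T2Space X] [LocallyCompactSpace X] {x : X} {O : Set X}
    (hO : IsOpen O) (hx : x ∈ O) :
    ∃ U : RegularOpens X, x ∈ U.toSet ∧ IsCompact (closure U.toSet) ∧ closure U.toSet ⊆ O := by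
  obtain ⟨K, hK, hxK, hKO⟩ := exists_compact_subset hO hx
  have hcl : closure (regularize (interior K)).toSet ⊆ K :=
    (closure_toSet_regularize_subset _).trans (closure_minimal interior_subset hK.isClosed)
  exact ⟨regularize (interior K), subset_toSet_regularize isOpen_interior hxK,
    hK.of_isClosed_subset isClosed_closure hcl, hcl.trans hKO⟩

end RegularOpens

/-! ### The MVD-algebra of regular open sets -/

open RegularOpens

section OfSpace

variable {X : Type u} [TopologicalSpace X]

/-- The relation "`cl U` is compact and contained in `V`". -/
def compactlyInside (U V : RegularOpens X) : Prop :=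
  IsCompact (closure U.toSet) ∧ closure U.toSet ⊆ V.toSet

theorem compactlyInside_top {U : RegularOpens X} :
    compactlyInside U ⊤ ↔ IsCompact (closure U.toSet) :=
  and_iff_left (Set.subset_univ _)

theorem toSet_sup_subset_closure (U V : RegularOpens X) :
    closure (U ⊔ V).toSet ⊆ closure U.toSet ∪ closure V.toSet := by
  have : U ⊔ V ≤ regularize (U.toSet ∪ V.toSet) :=
    sup_le (le_regularize_iff.2 (Set.subset_union_left.trans subset_closure))
      (le_regularize_iff.2 (Set.subset_union_right.trans subset_closure))
  rw [← closure_union]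
  exact closure_minimal (le_regularize_iff.1 this) isClosed_closure

theorem isMVDAlgebra_compactlyInside [T2Space X] [LocallyCompactSpace X] :
    IsMVDAlgebra (compactlyInside (X := X)) where
  le_of_ll U V h := subset_closure.trans h.2
  bot_ll_bot := by
    simp only [compactlyInside, toSet_bot, closure_empty]
    exact ⟨isCompact_empty, le_rfl⟩
  mono U V W T hUV hVW hWT :=
    have hcl := closure_mono (le_iff.1 hUV)
    ⟨hVW.1.of_isClosed_subset isClosed_closure hcl, hcl.trans (hVW.2.trans hWT)⟩
  sup_ll U V W hU hV := by
    have hcl := toSet_sup_subset_closure U V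
    exact ⟨(hU.1.union hV.1).of_isClosed_subset isClosed_closure hcl,
      hcl.trans (Set.union_subset hU.2 hV.2)⟩
  ll_inf U V W hV hW := ⟨hV.1, Set.subset_inter hV.2 hW.2⟩
  interpolate U W h := by
    obtain ⟨K, hK, hUK, hKW⟩ := exists_compact_between h.1 W.isOpen_toSet h.2
    have hcl : closure (regularize (interior K)).toSet ⊆ K :=
      (closure_toSet_regularize_subset _).trans (closure_minimal interior_subset hK.isClosed)
    exact ⟨regularize (interior K),
      ⟨h.1, hUK.trans (subset_toSet_regularize isOpen_interior)⟩,
      hK.of_isClosed_subset isClosed_closure hcl, hcl.trans hKW⟩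
  exists_inside U hU := by
    obtain ⟨x, hx⟩ := ne_bot_iff.1 hU
    obtain ⟨V, hxV, hV⟩ := exists_mem_closure_subset U.isOpen_toSet hx
    exact ⟨V, ne_bot_iff.2 ⟨x, hxV⟩, hV⟩
  mvd U V hU hVU := ⟨hU.1, by
    have := hVU.2
    rw [toSet_compl, toSet_compl, closure_compl, interior_closure_toSet,
      Set.compl_subset_compl] at this
    exact this⟩

/-- The complete MVD-algebra of regular open subsets of a locally compact Hausdorff space. -/
abbrev IA.ofSpace (X : Type u) [TopologicalSpace X] [T2Space X] [LocallyCompactSpace X] :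
    IA.{u} where
  carrier := RegularOpens X
  ll := compactlyInside
  isMVD := isMVDAlgebra_compactlyInside

/-- Relatively compact tests detect closedness locally. If every test `C` succeeds for `U`, a point
of `cl U` lying in `C` belongs to `(U ⊔ Cᶜ) ⊓ C ≤ U`, so `U` is clopen; conversely a clopen `U`
contains `cl (C ⊓ U)`. -/
theorem isConnected_ofSpace_iff [T2Space X] [LocallyCompactSpace X] :
    IA.IsConnected (IA.ofSpace X) ↔ PreconnectedSpace X := by
  constructor
  · intro h
    refine preconnectedSpace_iff_clopen.2 fun s hs => ?_
    by_contra! hne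
    let U : RegularOpens X := regularize s
    have hU : U.toSet = s := by
      rw [toSet_regularize, hs.isClosed.closure_eq, hs.isOpen.interior_eq]
    obtain ⟨C, hC, hn⟩ := h U (ne_bot_iff.2 (hU ▸ hne.1)) (fun ht => hne.2 (by
      rw [← hU, ht, toSet_top]))
    refine hn ⟨(compactlyInside_top.1 hC).of_isClosed_subset isClosed_closure
      (closure_mono Set.inter_subset_left), ?_⟩
    have hcl : closure (C ⊓ U : RegularOpens X).toSet ⊆ U.toSet := by
      refine closure_minimal Set.inter_subset_right ?_
      rw [hU]
      exact hs.isClosed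
    exact hcl.trans (le_iff.1 le_sup_left)
  · intro h (U : RegularOpens X) h0 h1
    by_contra! hn
    have hclosed : IsClosed U.toSet := by
      refine isClosed_of_closure_subset fun x hx => ?_
      obtain ⟨C, hxC, hC, -⟩ := exists_mem_closure_subset isOpen_univ (Set.mem_univ x)
      have hx' : x ∈ closure (C ⊓ U).toSet := by
        rw [toSet_inf]
        exact C.isOpen_toSet.inter_closure ⟨hxC, hx⟩
      have hx'' : x ∈ ((U ⊔ Cᶜ) ⊓ C).toSet :=
        ⟨(hn C (compactlyInside_top.2 hC)).2 hx', hxC⟩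
      rw [inf_sup_right, compl_inf_eq_bot, sup_bot_eq] at hx''
      exact hx''.1
    rcases isClopen_iff.1 ⟨hclosed, U.isOpen_toSet⟩ with he | he
    · exact h0 (toSet_injective he)
    · exact h1 (toSet_injective he)

end OfSpace

/-- A map of complete Boolean algebras preserving complements and joins is a complete
homomorphism. -/
def completeLatticeHomOfCompl {A B : Type*} [CompleteBooleanAlgebra A]
    [CompleteBooleanAlgebra B] (φ : A → B) (hc : ∀ a, φ aᶜ = (φ a)ᶜ)
    (hs : ∀ S : Set A, φ (sSup S) = sSup (φ '' S)) : CompleteLatticeHom A B where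
  toFun := φ
  map_sSup' := hs
  map_sInf' S := by
    rw [← compl_inj_iff, ← hc, compl_sInf', hs, compl_sInf', Set.image_image, Set.image_image]
    simp only [hc]

/-! ### Homomorphisms of regular open algebras induced by skeletal maps. -/

namespace RegularOpens

variable {X Y Z : Type*} [TopologicalSpace X] [TopologicalSpace Y] [TopologicalSpace Z]

/-- The regularized preimage of a regular open set. -/
def comap (f : X → Y) (V : RegularOpens Y) : RegularOpens X := regularize (f ⁻¹' V.toSet)

theorem toSet_comap (f : X → Y) (V : RegularOpens Y) :
    (comap f V).toSet = interior (closure (f ⁻¹' V.toSet)) := toSet_regularize _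

theorem preimage_subset_comap {f : X → Y} (hf : Continuous f) (V : RegularOpens Y) :
    f ⁻¹' V.toSet ⊆ (comap f V).toSet :=
  subset_toSet_regularize (V.isOpen_toSet.preimage hf)

end RegularOpens

section Skeletal

variable {X Y Z : Type u} [TopologicalSpace X] [TopologicalSpace Y] [TopologicalSpace Z]

/-- A non-empty open part of the preimage of `int cl W` has image dense in some non-empty open set;
that set lies in `cl W`, so it meets `W`, and then so does the image. This makes regularized
preimages functorial and join-preserving. -/
theorem IsSkeletal.closure_preimage {f : X → Y} (hs : IsSkeletal f) (hf : Continuous f)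
    {W : Set Y} (hW : IsOpen W) :
    closure (f ⁻¹' interior (closure W)) = closure (f ⁻¹' W) := by
  refine subset_antisymm (closure_minimal (fun x hx => ?_) isClosed_closure)
    (closure_mono (Set.preimage_mono hW.subset_interior_closure))
  refine mem_closure_iff.2 fun O hO hxO => ?_
  obtain ⟨y, hy⟩ := hs (O ∩ f ⁻¹' interior (closure W))
    (hO.inter (isOpen_interior.preimage hf)) ⟨x, hxO, hx⟩
  have hsub : closure (f '' (O ∩ f ⁻¹' interior (closure W))) ⊆ closure W := by
    refine closure_minimal ?_ isClosed_closure
    rintro _ ⟨z, hz, rfl⟩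
    exact interior_subset hz.2
  obtain ⟨w, hwN, hw⟩ := mem_closure_iff.1 (hsub (interior_subset hy)) _ isOpen_interior hy
  obtain ⟨_, hz', z, hz, rfl⟩ := mem_closure_iff.1 (interior_subset hwN) W hW hw
  exact ⟨z, hz.1, hz'⟩

theorem IsSkeletal.comap_compl {f : X → Y} (hs : IsSkeletal f) (hf : Continuous f)
    (V : RegularOpens Y) : comap f Vᶜ = (comap f V)ᶜ := by
  apply toSet_injective
  have hV := V.isOpen_toSet.preimage hf
  have hcl : closure (interior (closure (f ⁻¹' V.toSet))) = closure (f ⁻¹' V.toSet) :=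
    subset_antisymm (closure_minimal interior_subset isClosed_closure)
      (closure_mono hV.subset_interior_closure)
  rw [toSet_compl, toSet_comap, toSet_comap, hcl, toSet_compl]
  apply subset_antisymm
  · intro x hx hx'
    obtain ⟨y, hy, hyV⟩ := mem_closure_iff.1 hx' _ isOpen_interior hx
    obtain ⟨z, hzV, hz⟩ := mem_closure_iff.1 (interior_subset hy) _ hV hyV
    exact hz (subset_closure hzV)
  · refine interior_maximal (fun x hx => mem_closure_iff.2 fun O hO hxO => ?_)
      isClosed_closure.isOpen_compl
    -- The image of this open set misses `V`, hence so does the interior of its closure, which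
    -- forces `y` outside `cl V`.
    obtain ⟨y, hy⟩ := hs (O ∩ (closure (f ⁻¹' V.toSet))ᶜ)
      (hO.inter isClosed_closure.isOpen_compl) ⟨x, hxO, hx⟩
    have hyV : y ∈ (closure V.toSet)ᶜ := fun hyV => by
      obtain ⟨w, hw, hwV⟩ := mem_closure_iff.1 hyV _ isOpen_interior hy
      obtain ⟨_, hzV, z, hz, rfl⟩ := mem_closure_iff.1 (interior_subset hw) _ V.isOpen_toSet hwV
      exact hz.2 (subset_closure hzV)
    obtain ⟨_, hz', z, hz, rfl⟩ := mem_closure_iff.1 (interior_subset hy) _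
      isClosed_closure.isOpen_compl hyV
    exact ⟨z, hz.1, hz'⟩

theorem IsSkeletal.comap_sSup {f : X → Y} (hs : IsSkeletal f) (hf : Continuous f)
    (S : Set (RegularOpens Y)) : comap f (sSup S) = sSup (comap f '' S) := by
  apply le_antisymm
  · refine regularize_le ?_
    rw [toSet_sSup]
    refine subset_closure.trans ?_
    rw [hs.closure_preimage hf (isOpen_biUnion fun U _ => U.isOpen_toSet)]
    refine closure_mono ?_
    rw [Set.preimage_iUnion₂]
    refine Set.iUnion₂_subset fun U hU => ?_
    exact (preimage_subset_comap hf U).trans (le_iff.1 (le_sSup ⟨U, hU, rfl⟩))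
  · refine sSup_le ?_
    rintro _ ⟨U, hU, rfl⟩
    refine le_regularize_iff.2 ?_
    rw [toSet_comap]
    exact interior_subset.trans (closure_mono (Set.preimage_mono (le_iff.1 (le_sSup hU))))

/-- The complete Boolean homomorphism of regular open algebras induced by a skeletal map. -/
def IsSkeletal.comapHom {f : X → Y} (hs : IsSkeletal f) (hf : Continuous f) :
    CompleteLatticeHom (RegularOpens Y) (RegularOpens X) :=
  completeLatticeHomOfCompl (comap f) (hs.comap_compl hf) (hs.comap_sSup hf)

theorem IsSkeletal.comap_comp {g : Y → Z} {f : X → Y} (hf : Continuous f) (hg : Continuous g)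
    (hs : IsSkeletal f) (W : RegularOpens Z) : comap (g ∘ f) W = comap f (comap g W) := by
  apply toSet_injective
  rw [toSet_comap, toSet_comap, toSet_comap,
    hs.closure_preimage hf (W.isOpen_toSet.preimage hg), Set.preimage_comp]

/-- This turns (S2) and (SO) into statements about images of open sets. -/
theorem IsSkeletal.lowerAdjoint_comapHom {f : X → Y} (hs : IsSkeletal f) (hf : Continuous f)
    (U : RegularOpens X) : lowerAdjoint (hs.comapHom hf) U = regularize (f '' U.toSet) := by
  apply eq_of_forall_ge_iff
  intro V
  rw [gc_lowerAdjoint (hs.comapHom hf)]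
  change U ≤ comap f V ↔ _
  constructor
  · intro h
    refine regularize_le ?_
    rintro _ ⟨x, hx, rfl⟩
    exact closure_mono (Set.image_preimage_subset _ _)
      (image_closure_subset_closure_image hf ⟨x, le_regularize_iff.1 h hx, rfl⟩)
  · intro h
    refine le_regularize_iff.2 fun x hx => mem_closure_iff.2 fun O hO hxO => ?_
    obtain ⟨y, hy⟩ := hs (O ∩ U.toSet) (hO.inter U.isOpen_toSet) ⟨x, hxO, hx⟩
    have hyV : y ∈ V.toSet := by
      refine le_iff.1 h ?_
      rw [toSet_regularize]
      exact interior_mono (closure_mono (Set.image_mono Set.inter_subset_right)) hy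
    obtain ⟨_, hz', z, hz, rfl⟩ := mem_closure_iff.1 (interior_subset hy) _ V.isOpen_toSet hyV
    exact ⟨z, hz.1, hz'⟩

theorem compactlyInside_comap {f : X → Y} (hf : IsPerfectMap f) {U V : RegularOpens Y}
    (h : compactlyInside U V) : compactlyInside (comap f U) (comap f V) := by
  have hp := (isPerfectMap_iff_isProperMap f).1 hf
  have hcl : closure (comap f U).toSet ⊆ f ⁻¹' closure U.toSet :=
    (closure_toSet_regularize_subset _).trans
      (closure_minimal (Set.preimage_mono subset_closure) (isClosed_closure.preimage hf.continuous))
  exact ⟨(hp.isCompact_preimage h.1).of_isClosed_subset isClosed_closure hcl,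
    hcl.trans ((Set.preimage_mono h.2).trans (preimage_subset_comap hf.continuous V))⟩

theorem closure_regularize_image_subset {f : X → Y} (hf : IsPerfectMap f)
    (U : RegularOpens X) : closure (regularize (f '' U.toSet)).toSet ⊆ f '' closure U.toSet :=
  (closure_toSet_regularize_subset _).trans
    (closure_minimal (Set.image_mono subset_closure) (hf.isClosedMap _ isClosed_closure))

/-- If `f x ≠ g x`, disjoint regular neighbourhoods `V`, `W` of the two values have disjoint
regularized preimages, yet both of these contain `x`. -/
theorem comap_injective [T2Space Y] [LocallyCompactSpace Y] {f g : X → Y}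
    (hf : Continuous f) (hg : Continuous g) (h : ∀ V, comap f V = comap g V) (hs : IsSkeletal f) : f = g := by
  funext x
  by_contra hne
  obtain ⟨O, O', hO, hO', hxO, hxO', hd⟩ := t2_separation hne
  obtain ⟨V, hV, -, hVO⟩ := exists_mem_closure_subset hO hxO
  obtain ⟨W, hW, -, hWO⟩ := exists_mem_closure_subset hO' hxO'
  have hVW : V ⊓ W = ⊥ := toSet_injective
    (hd.mono (subset_closure.trans hVO) (subset_closure.trans hWO)).inter_eq
  refine disjoint_of_inf_eq_bot (U := comap f V) (V := comap f W) ?_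
    (preimage_subset_comap hf V hV) (h W ▸ preimage_subset_comap hg W hW)
  exact (map_inf (hs.comapHom hf) V W).symm.trans ((congrArg _ hVW).trans
    (map_bot (hs.comapHom hf)))

theorem isSkeletal_of_isOpenMap {f : X → Y} (hf : IsOpenMap f) : IsSkeletal f :=
  fun U hU hne => (hne.image f).mono (interior_maximal subset_closure (hf U hU))

variable [T2Space X] [LocallyCompactSpace X] [T2Space Y] [LocallyCompactSpace Y]

/-- The morphism of MVD-algebras induced by a skeletal perfect map. -/
def IA.homOfMap {f : X → Y} (hs : IsSkeletal f) (hf : IsPerfectMap f) :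
    IA.Hom (IA.ofSpace Y) (IA.ofSpace X) where
  toHom := hs.comapHom hf.continuous
  map_ll _ _ h := compactlyInside_comap hf h
  lower_ll_top (U : RegularOpens X) hU := by
    change compactlyInside (lowerAdjoint (hs.comapHom hf.continuous) U) _
    rw [compactlyInside_top, hs.lowerAdjoint_comapHom]
    exact ((compactlyInside_top.1 hU).image hf.continuous).of_isClosed_subset isClosed_closure
      (closure_regularize_image_subset hf U)
  map_ll_top (V : RegularOpens Y) hV := compactlyInside_top.2 (compactlyInside_comap hf hV).1

theorem openIA_homOfMap_iff {f : X → Y} (hs : IsSkeletal f) (hf : IsPerfectMap f) :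
    openIA (X := IA.ofSpace Y) (Y := IA.ofSpace X) (IA.homOfMap hs hf) ↔ IsOpenMap f := by
  have hll : ∀ (V : RegularOpens Y) (U : RegularOpens X),
      compactlyInside (lowerAdjoint (hs.comapHom hf.continuous) U) V ↔
        compactlyInside (regularize (f '' U.toSet)) V := fun V U => by
    rw [hs.lowerAdjoint_comapHom]
  constructor
  · intro h
    refine isOpenMap_iff_nhds_le.2 fun x O hO => ?_
    obtain ⟨O', hO', hO'o, hxO'⟩ := mem_nhds_iff.1 (Filter.mem_map.1 hO)
    obtain ⟨U, hxU, hU, hUO⟩ := exists_mem_closure_subset hO'o hxO'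
    obtain ⟨U₀, hxU₀, hU₀, hUU₀⟩ := exists_mem_closure_subset U.isOpen_toSet hxU
    have hle : U ≤ comap f (regularize (f '' U.toSet)) := by
      have := (gc_lowerAdjoint (hs.comapHom hf.continuous)).le_u_l U
      rwa [hs.lowerAdjoint_comapHom] at this
    have h1 : compactlyInside (regularize (f '' U₀.toSet)) (regularize (f '' U.toSet)) :=
      (hll _ _).1 (h _ _ ⟨hU₀, hUU₀.trans hle⟩)
    have hx : f x ∈ (regularize (f '' U.toSet)).toSet := by
      -- The point `f x` need not lie in `int cl f(U₀)`, but skeletality on ever smaller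
      -- neighbourhoods of `x` puts it in the closure, and (SO) puts that closure inside `int cl
      -- f(U)`.
      refine h1.2 (mem_closure_iff.2 fun N hN hxN => ?_)
      obtain ⟨y, hy⟩ := hs (U₀.toSet ∩ f ⁻¹' N)
        (U₀.isOpen_toSet.inter (hN.preimage hf.continuous)) ⟨x, hxU₀, hxN⟩
      obtain ⟨_, hz', z, hz, rfl⟩ := mem_closure_iff.1 (interior_subset hy) _ isOpen_interior hy
      refine ⟨f z, hz.2, ?_⟩
      rw [toSet_regularize]
      exact interior_mono (closure_mono (Set.image_mono Set.inter_subset_left)) hz'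
    refine Filter.mem_of_superset ((regularize _).isOpen_toSet.mem_nhds hx) ?_
    refine subset_closure.trans ((closure_regularize_image_subset hf U).trans ?_)
    exact Set.image_subset_iff.2 (hUO.trans hO')
  · intro ho (V : RegularOpens Y) (U : RegularOpens X) hUV
    refine (hll _ _).2 ?_
    -- Preimages under an open continuous map commute with closure and interior, so `comap f V` is
    -- the plain preimage.
    have hUV' : closure U.toSet ⊆ f ⁻¹' V.toSet := by
      refine hUV.2.trans ?_
      change (comap f V).toSet ⊆ _
      rw [toSet_comap, ← ho.preimage_closure_eq_closure_preimage hf.continuous,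
        ← ho.preimage_interior_eq_interior_preimage hf.continuous, interior_closure_toSet]
    have hcl := closure_regularize_image_subset hf U
    exact ⟨(hUV.1.image hf.continuous).of_isClosed_subset isClosed_closure hcl,
      hcl.trans (Set.image_subset_iff.2 hUV')⟩

end Skeletal

/-! ### Recovering a skeletal perfect map from a homomorphism. -/

section Full

variable {X Y : Type u} [TopologicalSpace X] [TopologicalSpace Y] [T2Space X]
  [LocallyCompactSpace X] [T2Space Y] [LocallyCompactSpace Y]

theorem toSet_hom_compl (φ : IA.Hom (IA.ofSpace Y) (IA.ofSpace X)) (V : RegularOpens Y) :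
    (φ.toHom Vᶜ).toSet = (closure (φ.toHom V).toSet)ᶜ := by
  rw [← toSet_compl]
  exact congrArg toSet
    (map_compl' (F := CompleteLatticeHom (RegularOpens Y) (RegularOpens X)) φ.toHom V)

/-- The sets `V` with `x ∈ φ V` form a filter, and (S2) puts into it some `W` with compact closure,
so the closures of its members below `W` share a point `y`. If `y ∈ V` but `x ∉ φ V`, take `V₁ ≪ V`
around `y`: then `x ∈ φ V₁ᶜ`, so `y` is in the closure of `V₁ᶜ ⊓ W`, which misses `V₁`. -/
theorem exists_point_of_hom (φ : IA.Hom (IA.ofSpace Y) (IA.ofSpace X)) (x : X) :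
    ∃ y : Y, ∀ V : RegularOpens Y, y ∈ V.toSet → x ∈ (φ.toHom V).toSet := by
  obtain ⟨U, hxU, hU, -⟩ := exists_mem_closure_subset isOpen_univ (Set.mem_univ x)
  let W : RegularOpens Y := lowerAdjoint φ.toHom U
  have hW : IsCompact (closure W.toSet) :=
    compactlyInside_top.1 (φ.lower_ll_top U (compactlyInside_top.2 hU))
  have hxW : x ∈ (φ.toHom W).toSet := (gc_lowerAdjoint φ.toHom).le_u_l U hxU
  have hinf : ∀ {V V' : RegularOpens Y}, x ∈ (φ.toHom V).toSet → x ∈ (φ.toHom V').toSet →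
      x ∈ (φ.toHom (V ⊓ V')).toSet := fun {V V'} h h' => by
    rw [map_inf]
    exact ⟨h, h'⟩
  have hne : ∀ {V : RegularOpens Y}, x ∈ (φ.toHom V).toSet → V.toSet.Nonempty :=
    fun {V} h => ne_bot_iff.1 fun h0 => by
      rw [h0, map_bot] at h
      exact h
  let ι := {V : RegularOpens Y // V ≤ W ∧ x ∈ (φ.toHom V).toSet}
  have : Nonempty ι := ⟨⟨W, le_rfl, hxW⟩⟩
  obtain ⟨y, hy⟩ := IsCompact.nonempty_iInter_of_directed_nonempty_isCompact_isClosed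
    (fun V : ι => closure V.1.toSet)
    (fun V V' => ⟨⟨V.1 ⊓ V'.1, inf_le_left.trans V.2.1, hinf V.2.2 V'.2.2⟩,
      closure_mono Set.inter_subset_left, closure_mono Set.inter_subset_right⟩)
    (fun V => (hne V.2.2).closure)
    (fun V => hW.of_isClosed_subset isClosed_closure (closure_mono (le_iff.1 V.2.1)))
    (fun V => isClosed_closure)
  refine ⟨y, fun V hyV => ?_⟩
  obtain ⟨V₁, hyV₁, hV₁⟩ := exists_mem_closure_subset V.isOpen_toSet hyV
  by_contra hx
  have hx₁ : x ∈ (φ.toHom V₁ᶜ).toSet := by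
    rw [toSet_hom_compl]
    exact fun h => hx ((φ.map_ll V₁ V hV₁).2 h)
  have := Set.mem_iInter.1 hy ⟨V₁ᶜ ⊓ W, inf_le_right, hinf hx₁ hxW⟩
  obtain ⟨z, hz, hz', -⟩ := mem_closure_iff.1 this _ V₁.isOpen_toSet hyV₁
  exact (toSet_compl V₁).subset hz' (subset_closure hz)

/-- Each property of the pointwise choice comes from one feature of `φ`: continuity from
complements, `comap f = φ` from joins because `V` is the join of all `V₁ ≪ V`, properness from (S3),
and skeletality from the lower adjoint. -/
theorem exists_map_of_hom (φ : IA.Hom (IA.ofSpace Y) (IA.ofSpace X)) :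
    ∃ (f : X → Y) (hs : IsSkeletal f) (hf : IsPerfectMap f), IA.homOfMap hs hf = φ := by
  choose f hfφ using exists_point_of_hom φ
  have hcl : ∀ (V : RegularOpens Y) (x : X), x ∈ (φ.toHom V).toSet → f x ∈ closure V.toSet := by
    intro V x hx
    by_contra hn
    have h := hfφ x Vᶜ (by rwa [toSet_compl])
    rw [toSet_hom_compl] at h
    exact h (subset_closure hx)
  have hcont : Continuous f := by
    refine continuous_iff_continuousAt.2 fun x => ?_
    intro O hO
    obtain ⟨O', hO', hO'o, hxO'⟩ := mem_nhds_iff.1 hO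
    obtain ⟨V, hxV, -, hVO⟩ := exists_mem_closure_subset hO'o hxO'
    refine Filter.mem_map.2 (Filter.mem_of_superset
      ((φ.toHom V).isOpen_toSet.mem_nhds (hfφ x V hxV)) fun z hz => ?_)
    exact hO' (hVO (hcl V z hz))
  have hcomap : ∀ V : RegularOpens Y, comap f V = φ.toHom V := by
    intro V
    apply le_antisymm
    · exact regularize_le (subset_trans (fun x hx => hfφ x V hx) subset_closure)
    · have hV : V = sSup {V₁ | compactlyInside V₁ V} := by
        apply le_antisymm
        · intro y hy
          obtain ⟨V₁, hyV₁, hV₁⟩ := exists_mem_closure_subset V.isOpen_toSet hy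
          exact le_iff.1 (le_sSup (show V₁ ∈ {V₁ | compactlyInside V₁ V} from hV₁)) hyV₁
        · exact sSup_le fun V₁ h => subset_closure.trans h.2
      conv_lhs => rw [hV, map_sSup]
      refine sSup_le ?_
      rintro _ ⟨V₁, hV₁, rfl⟩
      exact fun x hx => preimage_subset_comap hcont V (hV₁.2 (hcl V₁ x hx))
  have hperf : IsPerfectMap f := by
    refine (isPerfectMap_iff_isProperMap f).2
      (isProperMap_iff_isCompact_preimage.2 ⟨hcont, fun K hK => ?_⟩)
    obtain ⟨L, hL, hKL⟩ := exists_compact_superset hK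
    let W : RegularOpens Y := regularize (interior L)
    have hW : compactlyInside W ⊤ := compactlyInside_top.2 (hL.of_isClosed_subset
      isClosed_closure ((closure_toSet_regularize_subset _).trans
        (closure_minimal interior_subset hL.isClosed)))
    refine (compactlyInside_top.1 (φ.map_ll_top W hW)).of_isClosed_subset
      (hK.isClosed.preimage hcont) fun x hx => subset_closure (hfφ x W ?_)
    exact subset_toSet_regularize isOpen_interior (hKL hx)
  have hskel : IsSkeletal f := by
    rintro U hU ⟨x, hx⟩
    obtain ⟨U₀, hxU₀, -, hU₀⟩ := exists_mem_closure_subset hU hx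
    -- The open set sought inside `cl f(U)` is `φ_Λ U₀`: were some `V'` meeting it disjoint from
    -- `f(U)`, then `U₀ ≤ φ V'ᶜ`, whence `φ_Λ U₀ ≤ V'ᶜ`.
    let V : RegularOpens Y := lowerAdjoint φ.toHom U₀
    have hUV : U₀ ≤ φ.toHom V := (gc_lowerAdjoint φ.toHom).le_u_l U₀
    have hV : V.toSet.Nonempty := by
      refine ne_bot_iff.1 fun h0 => ?_
      rw [h0, map_bot] at hUV
      exact hUV hxU₀
    refine hV.mono (interior_maximal (fun y hy => mem_closure_iff.2 fun O hO hyO => ?_)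
      V.isOpen_toSet)
    by_contra hn
    obtain ⟨V', hyV', -, hV'⟩ := exists_mem_closure_subset hO hyO
    have hle : U₀ ≤ φ.toHom V'ᶜ := by
      rw [← hcomap]
      refine le_regularize_iff.2 (subset_trans (fun z hz => ?_) subset_closure)
      rw [Set.mem_preimage, toSet_compl]
      exact fun hz' => hn ⟨f z, hV' hz', z, hU₀ (subset_closure hz), rfl⟩
    have := (gc_lowerAdjoint φ.toHom _ _).2 hle hy
    change y ∈ V'ᶜ.toSet at this
    rw [toSet_compl] at this
    exact this (subset_closure hyV')
  refine ⟨f, hskel, hperf, IA.Hom.ext (DFunLike.ext _ _ hcomap)⟩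

end Full

/-! ### The space of ends of an MVD-algebra -/

section RoundFilter

variable {B : Type u} [BooleanAlgebra B] {ll : B → B → Prop}

/-- Proper round filters with respect to a relation `ll`. -/
structure IsRoundFilter (ll : B → B → Prop) (F : Set B) : Prop where
  top_mem : ⊤ ∈ F
  bot_notMem : ⊥ ∉ F
  mem_of_le : ∀ {a b}, a ∈ F → a ≤ b → b ∈ F
  inf_mem : ∀ {a b}, a ∈ F → b ∈ F → a ⊓ b ∈ F
  round : ∀ {a}, a ∈ F → ∃ b ∈ F, ll b a

theorem IsRoundFilter.exists_maximal {F : Set B} (hF : IsRoundFilter ll F) :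
    ∃ M, F ⊆ M ∧ Maximal (IsRoundFilter ll) M := by
  refine zorn_subset_nonempty {M | IsRoundFilter ll M} (fun c hc hchain hne => ?_) F hF
  refine ⟨⋃₀ c, ?_, fun s hs => Set.subset_sUnion_of_mem hs⟩
  obtain ⟨s, hs⟩ := hne
  exact
    { top_mem := ⟨s, hs, (hc hs).top_mem⟩
      bot_notMem := fun ⟨t, ht, h⟩ => (hc ht).bot_notMem h
      mem_of_le := fun ⟨t, ht, h⟩ hab => ⟨t, ht, (hc ht).mem_of_le h hab⟩
      inf_mem := by
        rintro a b ⟨t, ht, ha⟩ ⟨t', ht', hb⟩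
        rcases hchain.total ht ht' with h | h
        · exact ⟨t', ht', (hc ht').inf_mem (h ha) hb⟩
        · exact ⟨t, ht, (hc ht).inf_mem ha (h hb)⟩
      round := fun ⟨t, ht, h⟩ => by
        obtain ⟨b, hb, hba⟩ := (hc ht).round h
        exact ⟨b, ⟨t, ht, hb⟩, hba⟩ }

variable (h : IsMVDAlgebra ll)
include h

theorem IsMVDAlgebra.isRoundFilter_above {b : B} (hb : b ≠ ⊥) (hb' : ll b ⊤) :
    IsRoundFilter ll {c | ll b c} where
  top_mem := hb'
  bot_notMem H := hb (le_bot_iff.1 (h.le_of_ll _ _ H))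
  mem_of_le hab hac := h.mono _ _ _ _ le_rfl hab hac
  inf_mem h₁ h₂ := h.ll_inf _ _ _ h₁ h₂
  round H := h.interpolate _ _ H

/-- This is the round part of the filter generated by `F` and `b`. It contains `F` and every `c`
with `b ≪ c`, though possibly not `b` itself. -/
theorem IsMVDAlgebra.isRoundFilter_trace {F : Set B} (hF : IsRoundFilter ll F) {b : B}
    (hb : ∀ f ∈ F, f ⊓ b ≠ ⊥) : IsRoundFilter ll {c | ∃ f ∈ F, ll (f ⊓ b) c} where
  top_mem := by
    obtain ⟨f, hf, hf'⟩ := hF.round hF.top_mem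
    exact ⟨f, hf, h.mono _ _ _ _ inf_le_left hf' le_rfl⟩
  bot_notMem := fun ⟨f, hf, H⟩ => hb f hf (le_bot_iff.1 (h.le_of_ll _ _ H))
  mem_of_le := fun ⟨f, hf, H⟩ hac => ⟨f, hf, h.mono _ _ _ _ le_rfl H hac⟩
  inf_mem := fun ⟨f, hf, H⟩ ⟨f', hf', H'⟩ => ⟨f ⊓ f', hF.inf_mem hf hf',
    h.mono _ _ _ _ (le_inf (inf_le_inf_right _ inf_le_left) (inf_le_inf_right _ inf_le_right))
      (h.inf_ll_inf H H') le_rfl⟩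
  round := fun ⟨f, hf, H⟩ => by
    obtain ⟨d, hd, hda⟩ := h.interpolate _ _ H
    exact ⟨d, ⟨f, hf, hd⟩, hda⟩

end RoundFilter

/-- The ends of an MVD-algebra: its maximal proper round filters. -/
def IA.End (A : IA.{u}) : Type u := {F : Set A.carrier // Maximal (IsRoundFilter A.ll) F}

namespace IA.End

variable {A : IA.{u}}

/-- The set of ends containing a given element. -/
def basic (a : A.carrier) : Set A.End := {p | a ∈ p.1}

theorem exists_superset {F : Set A.carrier} (hF : IsRoundFilter A.ll F) :
    ∃ p : A.End, F ⊆ p.1 := by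
  obtain ⟨M, hFM, hM⟩ := hF.exists_maximal
  exact ⟨⟨M, hM⟩, hFM⟩

theorem isRoundFilter (p : A.End) : IsRoundFilter A.ll p.1 := p.2.prop

theorem exists_mem {a : A.carrier} (ha : a ≠ ⊥) : ∃ p : A.End, p ∈ basic a := by
  obtain ⟨b, hb, hba⟩ := A.isMVD.exists_inside a ha
  obtain ⟨p, hp⟩ := exists_superset (A.isMVD.isRoundFilter_above hb (A.isMVD.ll_top hba))
  exact ⟨p, hp hba⟩

theorem mem_of_trace (p : A.End) {b c f : A.carrier} (hb : ∀ f ∈ p.1, f ⊓ b ≠ ⊥)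
    (hf : f ∈ p.1) (hc : A.ll (f ⊓ b) c) : c ∈ p.1 := by
  refine p.2.le_of_ge (A.isMVD.isRoundFilter_trace p.isRoundFilter hb) (fun g hg => ?_)
    ⟨f, hf, hc⟩
  obtain ⟨g', hg', hgg⟩ := p.isRoundFilter.round hg
  exact ⟨g', hg', A.isMVD.mono _ _ _ _ inf_le_left hgg le_rfl⟩

/-- This is the substitute for primeness: ends need not be ultrafilters, so the dichotomy is claimed
only across a gap `a ≪ c`. It follows by adjoining `a` to the end and using maximality. -/
theorem compl_mem_or_mem (p : A.End) {a c : A.carrier} (hac : A.ll a c) :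
    aᶜ ∈ p.1 ∨ c ∈ p.1 := by
  by_cases hb : ∀ f ∈ p.1, f ⊓ a ≠ ⊥
  · exact Or.inr (p.mem_of_trace hb p.isRoundFilter.top_mem
      (A.isMVD.mono _ _ _ _ inf_le_right hac le_rfl))
  · push Not at hb
    obtain ⟨f, hf, hfa⟩ := hb
    exact Or.inl (p.isRoundFilter.mem_of_le hf (le_compl_iff_disjoint_right.2
      (disjoint_iff.2 hfa)))

theorem basic_mono {a b : A.carrier} (hab : a ≤ b) : basic a ⊆ basic b :=
  fun p hp => p.isRoundFilter.mem_of_le hp hab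

theorem basic_inf (a b : A.carrier) : basic (a ⊓ b) = basic a ∩ basic b :=
  subset_antisymm (Set.subset_inter (basic_mono inf_le_left) (basic_mono inf_le_right))
    fun p hp => p.isRoundFilter.inf_mem hp.1 hp.2

theorem basic_bot : basic (⊥ : A.carrier) = ∅ :=
  Set.eq_empty_of_forall_notMem fun p hp => p.isRoundFilter.bot_notMem hp

theorem disjoint_basic_iff {a b : A.carrier} : Disjoint (basic a) (basic b) ↔ Disjoint a b := by
  rw [Set.disjoint_iff_inter_eq_empty, ← basic_inf, disjoint_iff]
  refine ⟨fun h => ?_, fun h => by rw [h, basic_bot]⟩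
  by_contra hne
  obtain ⟨p, hp⟩ := exists_mem hne
  exact (h ▸ hp : p ∈ (∅ : Set A.End))

instance : TopologicalSpace A.End where
  IsOpen W := ∀ p ∈ W, ∃ a, p ∈ basic a ∧ basic a ⊆ W
  isOpen_univ p _ := ⟨⊤, p.isRoundFilter.top_mem, Set.subset_univ _⟩
  isOpen_inter W W' hW hW' p hp := by
    obtain ⟨a, ha, haW⟩ := hW p hp.1
    obtain ⟨b, hb, hbW⟩ := hW' p hp.2
    refine ⟨a ⊓ b, p.isRoundFilter.inf_mem ha hb, ?_⟩
    rw [basic_inf]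
    exact Set.inter_subset_inter haW hbW
  isOpen_sUnion S hS p := by
    rintro ⟨W, hW, hp⟩
    obtain ⟨a, ha, haW⟩ := hS W hW p hp
    exact ⟨a, ha, haW.trans (Set.subset_sUnion_of_mem hW)⟩

theorem isOpen_basic (a : A.carrier) : IsOpen (basic a) := fun _ hp => ⟨a, hp, le_rfl⟩

theorem closure_basic (a : A.carrier) : closure (basic a) = (basic aᶜ)ᶜ := by
  apply subset_antisymm
  · exact closure_minimal (Set.disjoint_left.1 (disjoint_basic_iff.2 disjoint_compl_right))
      (isOpen_basic _).isClosed_compl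
  · intro p hp
    refine mem_closure_iff.2 fun O hO hpO => ?_
    obtain ⟨b, hb, hbO⟩ := hO p hpO
    by_contra hn
    refine hp (basic_mono (le_compl_iff_disjoint_right.2 (disjoint_basic_iff.1 ?_)) hb)
    refine Set.disjoint_left.2 fun q hq hq' => hn ⟨q, hbO hq, hq'⟩

theorem closure_basic_subset {a c : A.carrier} (hac : A.ll a c) :
    closure (basic a) ⊆ basic c := by
  rw [closure_basic]
  exact fun p hp => (p.compl_mem_or_mem hac).resolve_left hp

instance : T2Space A.End := by
  refine ⟨fun p q hpq => ?_⟩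
  obtain ⟨a, hap, haq⟩ : ∃ a ∈ p.1, a ∉ q.1 := by
    by_contra! hn
    exact hpq (Subtype.ext (p.2.eq_of_subset q.2.prop hn))
  obtain ⟨b, hb, hba⟩ := p.isRoundFilter.round hap
  exact ⟨basic b, basic bᶜ, isOpen_basic _, isOpen_basic _, hb,
    (q.compl_mem_or_mem hba).resolve_right haq, disjoint_basic_iff.2 disjoint_compl_right⟩

/-- The elements `c` admitting some `d ≪ c` with `basic d ∈ 𝒰` form a round filter, proper and
containing `⊤` thanks to a bounded `e` with `a ≪ e`. Any end extending it is a limit of `𝒰`. -/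
theorem isCompact_closure_basic {a : A.carrier} (ha : A.ll a ⊤) :
    IsCompact (closure (basic a)) := by
  obtain ⟨e, hae, he⟩ := A.isMVD.interpolate _ _ ha
  refine isCompact_iff_ultrafilter_le_nhds.2 fun 𝒰 h𝒰 => ?_
  have h𝒰a : closure (basic a) ∈ 𝒰 := Filter.le_principal_iff.1 h𝒰
  have h𝒰e : basic e ∈ 𝒰 := Filter.mem_of_superset h𝒰a (closure_basic_subset hae)
  have hF : IsRoundFilter A.ll {c | ∃ d, A.ll d c ∧ basic d ∈ 𝒰} :=
    { top_mem := ⟨e, he, h𝒰e⟩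
      bot_notMem := fun ⟨d, hd, h⟩ => by
        rw [le_bot_iff.1 (A.isMVD.le_of_ll _ _ hd), basic_bot] at h
        exact 𝒰.empty_notMem h
      mem_of_le := fun ⟨d, hd, h⟩ hab => ⟨d, A.isMVD.mono _ _ _ _ le_rfl hd hab, h⟩
      inf_mem := fun ⟨d, hd, h⟩ ⟨d', hd', h'⟩ => ⟨d ⊓ d', A.isMVD.inf_ll_inf hd hd', by
        rw [basic_inf]
        exact Filter.inter_mem h h'⟩
      round := fun ⟨d, hd, h⟩ => by
        obtain ⟨g, hdg, hg⟩ := A.isMVD.interpolate _ _ hd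
        exact ⟨g, ⟨d, hdg, h⟩, hg⟩ }
  obtain ⟨p, hp⟩ := exists_superset hF
  have hlim : (𝒰 : Filter A.End) ≤ nhds p := by
    intro O hO
    obtain ⟨O', hO', hO'o, hpO'⟩ := mem_nhds_iff.1 hO
    obtain ⟨c, hpc, hc⟩ := hO'o p hpO'
    refine Filter.mem_of_superset ?_ (hc.trans hO')
    by_contra hn
    -- Two shrinkings are needed: `c₁ ≪ c` puts `basic c₁ᶜ` into `𝒰`, and `c₂ ≪ c₁` then gives `e ⊓
    -- c₁ᶜ ≪ c₂ᶜ`, so that `c₂` and its complement both lie in `p`.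
    obtain ⟨c₁, hpc₁, hc₁⟩ := p.isRoundFilter.round hpc
    obtain ⟨c₂, hpc₂, hc₂⟩ := p.isRoundFilter.round hpc₁
    have h1 : basic c₁ᶜ ∈ 𝒰 := by
      refine Filter.mem_of_superset (Ultrafilter.compl_mem_iff_notMem.2 hn) ?_
      rw [Set.compl_subset_comm, ← closure_basic]
      exact closure_basic_subset hc₁
    have h2 : c₂ᶜ ∈ p.1 := hp ⟨e ⊓ c₁ᶜ,
      A.isMVD.mono _ _ _ _ le_rfl (A.isMVD.inf_compl_ll hc₂ he) inf_le_right, by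
        rw [basic_inf]
        exact Filter.inter_mem h𝒰e h1⟩
    refine p.isRoundFilter.bot_notMem ?_
    rw [← inf_compl_eq_bot (a := c₂)]
    exact p.isRoundFilter.inf_mem hpc₂ h2
  exact ⟨p, isClosed_closure.mem_of_frequently_of_tendsto (Filter.Eventually.frequently h𝒰a) hlim,
    hlim⟩

instance : WeaklyLocallyCompactSpace A.End where
  exists_compact_mem_nhds p := by
    obtain ⟨a, hpa, ha⟩ := p.isRoundFilter.round p.isRoundFilter.top_mem
    exact ⟨_, isCompact_closure_basic ha,
      Filter.mem_of_superset ((isOpen_basic a).mem_nhds hpa) subset_closure⟩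

theorem basic_subset_basic_iff {a b : A.carrier} : basic a ⊆ basic b ↔ a ≤ b := by
  refine ⟨fun h => ?_, basic_mono⟩
  rw [← disjoint_compl_right_iff, ← disjoint_basic_iff]
  exact (disjoint_basic_iff.2 disjoint_compl_right).mono_left h

theorem toSet_regularize_basic (a : A.carrier) : (regularize (basic a)).toSet = basic a := by
  rw [toSet_regularize, closure_basic, interior_compl, closure_basic, compl_compl, compl_compl]

theorem exists_basic_eq (U : RegularOpens A.End) : ∃ a : A.carrier, basic a = U.toSet := by
  refine ⟨sSup {b | basic b ⊆ U.toSet}, subset_antisymm ?_ fun p hp => ?_⟩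
  · refine subset_trans (interior_maximal (fun p hp => mem_closure_iff.2 fun O hO hpO => ?_)
      (isOpen_basic _)) U.interior_closure_toSet.subset
    obtain ⟨d, hpd, hd⟩ := hO p hpO
    by_contra hn
    -- Infinite distributivity is the point here: a basic set missing `U` is disjoint from each `b`,
    -- hence from their join, so `basic` of the join stays in `cl U`.
    have hdis : Disjoint (sSup {b | basic b ⊆ U.toSet}) d := by
      rw [sSup_disjoint_iff]
      refine fun b hb => disjoint_basic_iff.1 (Set.disjoint_left.2 fun q hq hq' => ?_)
      exact hn ⟨q, hd hq', hb hq⟩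
    exact Set.disjoint_left.1 (disjoint_basic_iff.2 hdis) hp hpd
  · obtain ⟨b, hpb, hb⟩ := U.isOpen_toSet p hp
    exact basic_mono (le_sSup (show b ∈ {b | basic b ⊆ U.toSet} from hb)) hpb

theorem ll_iff {a c : A.carrier} :
    A.ll a c ↔ IsCompact (closure (basic a)) ∧ closure (basic a) ⊆ basic c := by
  refine ⟨fun h => ⟨isCompact_closure_basic (A.isMVD.ll_top h), closure_basic_subset h⟩, ?_⟩
  rintro ⟨hK, hac⟩
  -- Roundness covers the closure by sets `basic c'` with `c' ≪ c`; compactness leaves finitely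
  -- many, and their join is still `≪ c`.
  have key : ∃ c', A.ll c' c ∧ closure (basic a) ⊆ basic c' := by
    refine hK.induction_on ⟨⊥, A.isMVD.bot_ll c, Set.empty_subset _⟩ ?_ ?_ ?_
    · rintro s t hst ⟨c', hc', ht⟩
      exact ⟨c', hc', hst.trans ht⟩
    · rintro s t ⟨c₁, hc₁, hs⟩ ⟨c₂, hc₂, ht⟩
      exact ⟨c₁ ⊔ c₂, A.isMVD.sup_ll _ _ _ hc₁ hc₂, Set.union_subset
        (hs.trans (basic_mono le_sup_left)) (ht.trans (basic_mono le_sup_right))⟩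
    · intro p hp
      obtain ⟨c', hpc', hc'⟩ := p.isRoundFilter.round (hac hp)
      exact ⟨basic c', mem_nhdsWithin_of_mem_nhds ((isOpen_basic c').mem_nhds hpc'), c', hc',
        le_rfl⟩
  obtain ⟨c', hc', hac'⟩ := key
  exact A.isMVD.mono _ _ _ _ (basic_subset_basic_iff.1 (subset_closure.trans hac')) hc' le_rfl

/-- A complete MVD-algebra is order isomorphic to the regular open algebra of its space of
ends. -/
noncomputable def orderIso (A : IA.{u}) : A.carrier ≃o RegularOpens A.End :=
  RelIso.ofSurjective
    (OrderEmbedding.ofMapLEIff (fun a : A.carrier => (regularize (basic a) : RegularOpens A.End))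
      fun a b => by
        rw [le_iff, toSet_regularize_basic, toSet_regularize_basic, basic_subset_basic_iff])
    fun U => by
      obtain ⟨a, ha⟩ := exists_basic_eq U
      exact ⟨a, toSet_injective ((toSet_regularize_basic a).trans ha)⟩

theorem toSet_orderIso (a : A.carrier) : (orderIso A a).toSet = basic a :=
  toSet_regularize_basic a

theorem compactlyInside_orderIso_iff {a c : A.carrier} :
    compactlyInside (orderIso A a) (orderIso A c) ↔ A.ll a c := by
  rw [ll_iff, compactlyInside, toSet_orderIso, toSet_orderIso]

end IA.End

/-! ### Isomorphisms of MVD-algebras -/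

section OrderIso

theorem lowerAdjoint_orderIso {A B : Type u} [CompleteBooleanAlgebra A]
    [CompleteBooleanAlgebra B] (e : A ≃o B) (b : B) :
    lowerAdjoint (CompleteLatticeHom.OrderIso.toCompleteLatticeHom e) b = e.symm b := by
  apply eq_of_forall_ge_iff
  intro a
  rw [gc_lowerAdjoint]
  exact e.symm_apply_le.symm

variable {A B : IA.{u}} (e : A.carrier ≃o B.carrier)
  (he : ∀ a b, B.ll (e a) (e b) ↔ A.ll a b)

/-- An order isomorphism compatible with the MVD-relations is a morphism of MVD-algebras. -/
def IA.homOfOrderIso : IA.Hom A B where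
  toHom := CompleteLatticeHom.OrderIso.toCompleteLatticeHom e
  map_ll a b h := (he a b).2 h
  lower_ll_top b h := by
    rw [lowerAdjoint_orderIso, ← he, e.apply_symm_apply, map_top]
    exact h
  map_ll_top a h := by
    have := (he a ⊤).2 h
    rwa [map_top] at this

include he in
theorem ll_orderIso_symm (a b : B.carrier) : A.ll (e.symm a) (e.symm b) ↔ B.ll a b := by
  rw [← he, e.apply_symm_apply, e.apply_symm_apply]

/-- An order isomorphism compatible with the MVD-relations is an isomorphism of MVD-algebras. -/
def IA.isoOfOrderIso : A ≅ B where
  hom := IA.homOfOrderIso e he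
  inv := IA.homOfOrderIso e.symm (ll_orderIso_symm e he)
  hom_inv_id := IA.Hom.ext (DFunLike.ext _ _ e.symm_apply_apply)
  inv_hom_id := IA.Hom.ext (DFunLike.ext _ _ e.apply_symm_apply)

theorem openIA_homOfOrderIso : openIA (X := A) (Y := B) (IA.homOfOrderIso e he) := by
  intro a b h
  change A.ll (lowerAdjoint (CompleteLatticeHom.OrderIso.toCompleteLatticeHom e) b) a
  rw [lowerAdjoint_orderIso, ← he, e.apply_symm_apply]
  exact h

include he in
theorem IA.IsConnected.of_orderIso (h : IA.IsConnected A) : IA.IsConnected B := by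
  intro b h0 h1
  obtain ⟨c, hc, hn⟩ := h (e.symm b) (by simpa using h0) (by simpa using h1)
  refine ⟨e c, ?_, fun H => hn ?_⟩
  · have := (he c ⊤).2 hc
    rwa [map_top] at this
  · rw [← he, map_inf, map_sup, map_compl, e.apply_symm_apply]
    exact H

end OrderIso

/-! ### The dual equivalences -/

instance (X : HLC.{u}) : T2Space X.obj := X.property.1

instance (X : HLC.{u}) : LocallyCompactSpace X.obj := X.property.2

/-- The space of ends of an MVD-algebra, as a locally compact Hausdorff space. -/
def IA.endSpace (A : IA.{u}) : HLC.{u} := ⟨TopCat.of A.End, inferInstance, inferInstance⟩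

/-- An MVD-algebra is isomorphic to the regular open algebra of its space of ends. -/
noncomputable def IA.endIso (A : IA.{u}) : IA.ofSpace A.endSpace.obj ≅ A :=
  (IA.isoOfOrderIso (B := IA.ofSpace A.End) (IA.End.orderIso A)
    fun _ _ => IA.End.compactlyInside_orderIso_iff).symm

theorem IA.openIA_endIso_hom (A : IA.{u}) : openIA A.endIso.hom :=
  openIA_homOfOrderIso (A := IA.ofSpace A.End) (B := A) (IA.End.orderIso A).symm
    (ll_orderIso_symm (B := IA.ofSpace A.End) (IA.End.orderIso A)
      fun _ _ => IA.End.compactlyInside_orderIso_iff)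

theorem IA.openIA_endIso_inv (A : IA.{u}) : openIA A.endIso.inv :=
  openIA_homOfOrderIso (A := A) (B := IA.ofSpace A.End) (IA.End.orderIso A)
    fun _ _ => IA.End.compactlyInside_orderIso_iff

theorem IA.preconnectedSpace_end {A : IA.{u}} (h : IA.IsConnected A) :
    PreconnectedSpace A.End :=
  isConnected_ofSpace_iff.1 (h.of_orderIso (B := IA.ofSpace A.End) (IA.End.orderIso A)
    fun _ _ => IA.End.compactlyInside_orderIso_iff)

/-- The morphism of `HLC` given by a continuous map. -/
def HLC.homMk {X Y : HLC.{u}} (f : X.obj → Y.obj) (hf : Continuous f) : X ⟶ Y :=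
  ObjectProperty.homMk (TopCat.ofHom ⟨f, hf⟩)

theorem HLC.hom_ext {X Y : HLC.{u}} {f g : X ⟶ Y} (h : HLC.fn f = HLC.fn g) : f = g :=
  ObjectProperty.hom_ext _ (TopCat.hom_ext (ContinuousMap.ext (congrFun h)))

/-- The morphism of MVD-algebras induced by a skeletal perfect map in `HLC`. -/
def IA.homOfFn {X Y : HLC.{u}} (f : X ⟶ Y) (hf : skeletalPerfect f) :
    IA.Hom (IA.ofSpace Y.obj) (IA.ofSpace X.obj) :=
  IA.homOfMap hf.1 hf.2

theorem IA.homOfFn_injective {X Y : HLC.{u}} {f g : X ⟶ Y} {hf : skeletalPerfect f}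
    {hg : skeletalPerfect g} (h : IA.homOfFn f hf = IA.homOfFn g hg) : f = g :=
  HLC.hom_ext (comap_injective hf.2.continuous hg.2.continuous
    (DFunLike.congr_fun (congrArg IA.Hom.toHom h)) hf.1)

theorem IA.homOfFn_surjective {X Y : HLC.{u}}
    (φ : IA.Hom (IA.ofSpace Y.obj) (IA.ofSpace X.obj)) :
    ∃ (f : X ⟶ Y) (hf : skeletalPerfect f), IA.homOfFn f hf = φ := by
  obtain ⟨f, hs, hf, h⟩ := exists_map_of_hom φ
  exact ⟨HLC.homMk f hf.continuous, ⟨hs, hf⟩, h⟩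

theorem IA.homOfFn_id (X : HLC.{u}) (h : skeletalPerfect (𝟙 X)) :
    IA.homOfFn (𝟙 X) h = 𝟙 (IA.ofSpace X.obj) :=
  IA.Hom.ext (DFunLike.ext _ _ fun U => regularize_toSet U)

theorem IA.homOfFn_comp {X Y Z : HLC.{u}} (f : X ⟶ Y) (g : Y ⟶ Z) (hf : skeletalPerfect f)
    (hg : skeletalPerfect g) (h : skeletalPerfect (f ≫ g)) :
    (IA.homOfFn (f ≫ g) h : IA.ofSpace Z.obj ⟶ IA.ofSpace X.obj) =
      CategoryStruct.comp (X := IA.ofSpace Z.obj) (Y := IA.ofSpace Y.obj) (Z := IA.ofSpace X.obj)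
        (IA.homOfFn g hg) (IA.homOfFn f hf) :=
  IA.Hom.ext (DFunLike.ext _ _ fun W => hf.1.comap_comp hf.2.continuous hg.2.continuous W)

theorem openPerfect_le_skeletalPerfect : openPerfect.{u} ≤ skeletalPerfect.{u} :=
  fun _ _ _ hf => ⟨isSkeletal_of_isOpenMap hf.1, hf.2⟩

/-- The contravariant functor taking a connected space to its algebra of regular open sets. -/
def slccToIAC : SLCC.{u}ᵒᵖ ⥤ IAC.{u} where
  obj X := ⟨IA.ofSpace X.unop.obj.obj.obj, isConnected_ofSpace_iff.2 X.unop.property⟩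
  map f := ObjectProperty.homMk (IA.homOfFn f.unop.hom.hom f.unop.hom.property)
  map_id _ := ObjectProperty.hom_ext _ (IA.homOfFn_id _ (skeletalPerfect.id_mem _))
  map_comp f g := ObjectProperty.hom_ext _
    (IA.homOfFn_comp g.unop.hom.hom f.unop.hom.hom g.unop.hom.property f.unop.hom.property
      (skeletalPerfect.comp_mem _ _ g.unop.hom.property f.unop.hom.property))

/-- The restriction of `slccToIAC` to open perfect maps. -/
def oplccToIPAC : OPLCC.{u}ᵒᵖ ⥤ IPAC.{u} where
  obj X := ⟨⟨IA.ofSpace X.unop.obj.obj.obj⟩, isConnected_ofSpace_iff.2 X.unop.property⟩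
  map f := ObjectProperty.homMk
    ⟨IA.homOfFn f.unop.hom.hom (openPerfect_le_skeletalPerfect _ f.unop.hom.property),
      (openIA_homOfMap_iff _ _).2 f.unop.hom.property.1⟩
  map_id _ := ObjectProperty.hom_ext _ (WideSubcategory.hom_ext _
    (IA.homOfFn_id _ (skeletalPerfect.id_mem _)))
  map_comp f g := ObjectProperty.hom_ext _ (WideSubcategory.hom_ext _
    (IA.homOfFn_comp g.unop.hom.hom f.unop.hom.hom
      (openPerfect_le_skeletalPerfect _ g.unop.hom.property)
      (openPerfect_le_skeletalPerfect _ f.unop.hom.property)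
      (openPerfect_le_skeletalPerfect _
        (openPerfect.comp_mem _ _ g.unop.hom.property f.unop.hom.property))))

instance : slccToIAC.{u}.IsEquivalence where
  faithful := ⟨fun {X Y f g} h => Quiver.Hom.unop_inj (ObjectProperty.hom_ext _
    (WideSubcategory.hom_ext _ (IA.homOfFn_injective
      (hf := f.unop.hom.property) (hg := g.unop.hom.property)
      (congrArg InducedCategory.Hom.hom h))))⟩
  full := ⟨fun {X Y} φ => by
    obtain ⟨f, hf, h⟩ := IA.homOfFn_surjective φ.hom
    exact ⟨Quiver.Hom.op (ObjectProperty.homMk ⟨f, hf⟩), ObjectProperty.hom_ext _ h⟩⟩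
  essSurj := ⟨fun A => ⟨Opposite.op ⟨⟨A.obj.endSpace⟩, IA.preconnectedSpace_end A.property⟩,
    ⟨ObjectProperty.isoMk _ A.obj.endIso⟩⟩⟩

instance : oplccToIPAC.{u}.IsEquivalence where
  faithful := ⟨fun {X Y f g} h => Quiver.Hom.unop_inj (ObjectProperty.hom_ext _
    (WideSubcategory.hom_ext _ (IA.homOfFn_injective
      (hf := openPerfect_le_skeletalPerfect _ f.unop.hom.property)
      (hg := openPerfect_le_skeletalPerfect _ g.unop.hom.property)
      (congrArg (fun φ => φ.hom.hom) h))))⟩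
  full := ⟨fun {X Y} φ => by
    obtain ⟨f, hf, h⟩ := IA.homOfFn_surjective φ.hom.hom
    have ho : IsOpenMap (HLC.fn f) := (openIA_homOfMap_iff hf.1 hf.2).1
      (by
        change openIA (IA.homOfFn f hf)
        rw [h]
        exact φ.hom.property)
    exact ⟨Quiver.Hom.op (ObjectProperty.homMk ⟨f, ho, hf.2⟩),
      ObjectProperty.hom_ext _ (WideSubcategory.hom_ext _ h)⟩⟩
  essSurj := ⟨fun A => ⟨Opposite.op ⟨⟨A.obj.obj.endSpace⟩, IA.preconnectedSpace_end A.property⟩,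
    ⟨ObjectProperty.isoMk _ (WideSubcategory.isoMk A.obj.obj.endIso
      A.obj.obj.openIA_endIso_hom A.obj.obj.openIA_endIso_inv)⟩⟩⟩

end MVDDuality

theorem mainTheorem12 :
    (MVDDuality.AreIsomorphic MVDDuality.SALC.{u} MVDDuality.IAC.{u} ∧
      MVDDuality.AreDuallyEquivalent MVDDuality.SLCC.{u} MVDDuality.IAC.{u}) ∧
    (MVDDuality.AreIsomorphic MVDDuality.OPALC.{u} MVDDuality.IPAC.{u} ∧
      MVDDuality.AreDuallyEquivalent MVDDuality.OPLCC.{u} MVDDuality.IPAC.{u}) := by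
  exact ⟨⟨MVDDuality.areIsomorphic_SALC_IAC, ⟨MVDDuality.slccToIAC.asEquivalence⟩⟩,
    MVDDuality.areIsomorphic_OPALC_IPAC, ⟨MVDDuality.oplccToIPAC.asEquivalence⟩⟩
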